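/- **Theorem 1.3.** An integer-valued random variable $X$ with probability mass function $p(j)=\mathbb P(X=j)$ is called discrete log-concave if $p(j)^2\ge p(j-1)\,p(j+1)$ for all $j\in\mathbb Z$ and the support $\{j\in\mathbb Z: p(j)>0\}$ is an integer interval (that is, contains every integer lying between two of its elements). For an integer $l\ge 1$ and $m,x\in\mathbb R$, write $A_{l,m}(x)=\{x+mj: j=1,\dots,l\}$. Let $n\ge 1$ and let $X_1,\dots,X_n$ be independent, integer-valued, discrete log-concave random variables with finite support. Let $a_1,\dots,a_n$ be nonzero real numbers, let $l\ge 1$ be an integer and let $m\in\mathbb R$. Then $$\sup_{x\in\mathbb R}\ \mathbb P\bigl(a_1X_1+\cdots+a_nX_n\in A_{l,m}(x)\bigr)\ \le\ \frac{l}{\sqrt{1+c\sum_{k=1}^n\operatorname{Var}(X_k)+c\,\frac{l^2-1}{12}}}$$ with $c=1$. Moreover, if in addition the distribution of each $X_k$ is symmetric about a point (that is, for each $k$ there is $s_k\in\mathbb R$ such that $X_k-s_k$ and $s_k-X_k$ have the same distribution), then the inequality holds with $c=2$. -/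

import Mathlib

open MeasureTheory ProbabilityTheory

namespace LittlewoodOfford

/-- The probability mass function of an integer-valued random variable. -/
noncomputable def pmf {Ω : Type*} [MeasurableSpace Ω] (P : Measure Ω) (X : Ω → ℤ) (j : ℤ) : ℝ :=
  P.real {ω | X ω = j}

/-- `X` is discrete log-concave: its probability mass function `p` satisfies
`p (j - 1) * p (j + 1) ≤ p j ^ 2` for all integers `j`, and the support of `p` is an
integer interval. -/
def IsDiscreteLogConcave {Ω : Type*} [MeasurableSpace Ω] (P : Measure Ω) (X : Ω → ℤ) : Prop :=
  (∀ j : ℤ, pmf P X (j - 1) * pmf P X (j + 1) ≤ pmf P X j ^ 2) ∧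
    (Function.support (pmf P X)).OrdConnected

/-- `X` is finitely supported: its probability mass function has finite support. -/
def IsFinitelySupported {Ω : Type*} [MeasurableSpace Ω] (P : Measure Ω) (X : Ω → ℤ) : Prop :=
  (Function.support (pmf P X)).Finite

/-- The distribution of `X` is symmetric about a (real) point `c`: `X - c` and `c - X` have
the same law. -/
def IsSymmetricAboutPoint {Ω : Type*} [MeasurableSpace Ω] (P : Measure Ω) (X : Ω → ℤ) : Prop :=
  ∃ c : ℝ, P.map (fun ω => (X ω : ℝ) - c) = P.map (fun ω => c - (X ω : ℝ))

/-- The arithmetic progression `{x + m j : j = 1, …, l}`. -/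
def arithProg (l : ℕ) (m x : ℝ) : Set ℝ :=
  {y | ∃ j : ℕ, 1 ≤ j ∧ j ≤ l ∧ y = x + m * j}

end LittlewoodOfford

/-!
Reflecting `X k` to `-X k` where `a k < 0`, all coefficients may be taken positive. Put
`S = ∑ k, X k` and `Z = ∑ k, a k * X k`. Given independent log-concave summands, the conditional
law of `(X 1, …, X n)` given `S = r` moves up monotonically with `r` (Efron's theorem), so the
conditional law of `Z` given `S = r` is strictly increasing in `r`, in the sense that
`ℙ (Z ≤ t | S = r + 1) ≤ ℙ (Z < t | S = r)`. This is the invariant `StrictlyIncreasingGiven`; it is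
built up one variable at a time by `StrictlyIncreasingGiven.add`, where the monotone coupling for
two variables is explicit (`tsum_mul_tsum_le_of_interlacing`). Summing
`ℙ (Z = x | S = r) ≤ ℙ (Z ≤ x | S = r) - ℙ (Z ≤ x | S = r + 1)` over `r` telescopes to
`∑ r, ℙ (Z = x | S = r) ≤ 1`, hence `ℙ (Z = x)` is at most the largest atom of `S`
(`StrictlyIncreasingGiven.measureReal_eq_le`).

A progression of length `l` and difference `m ≠ 0` is handled by one more independent variable `J`,
uniform on `{1, …, l}`, with coefficient `-m`: hitting the progression has `l` times the probability
of an atom of `Z - m * J`. As `J` is log-concave, symmetric and of variance `(l ^ 2 - 1) / 12`, only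
the largest atom of the log-concave variable `S + J` has to be bounded.

For a log-concave probability sequence `f` on `ℤ` with variance `V` one has
`f m ^ 2 * (1 + V) ≤ 1` for every `m`, and `f m ^ 2 * (1 + 2 * V) ≤ 1` under symmetry
(`LogConcaveSeq.sq_mul_variance_le`, `LogConcaveSeq.sq_mul_le_of_symm`). On each side of `m` the
iterated tail sums of `f` form a log-concave sequence (`half_line_moments`), which bounds the
moments by those of a geometric sequence; what remains is a polynomial inequality.
-/

namespace LittlewoodOfford

/-! ### Log-concave sequences and their convolutions -/

open Finset in
/-- The half of the Cauchy–Binet (Andréief) identity that is needed: if all the `2 × 2` minors of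
`(x, y)` and of `(s, t)` are nonnegative, so is the minor of the matrix of their pairings. -/
theorem sum_mul_sum_le_of_minors {ι : Type*} [LinearOrder ι] (T : Finset ι) (x y s t : ι → ℝ)
    (hxy : ∀ k l, k < l → x l * y k ≤ x k * y l) (hst : ∀ k l, k < l → s l * t k ≤ s k * t l) :
    (∑ k ∈ T, y k * s k) * (∑ k ∈ T, x k * t k) ≤
      (∑ k ∈ T, x k * s k) * (∑ k ∈ T, y k * t k) := by
  have key : 0 ≤ ∑ k ∈ T, ∑ l ∈ T, (x k * y l - x l * y k) * (s k * t l - s l * t k) := by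
    refine sum_nonneg fun k _ => sum_nonneg fun l _ => ?_
    rcases lt_trichotomy k l with h | h | h
    · exact mul_nonneg (sub_nonneg.2 (hxy k l h)) (sub_nonneg.2 (hst k l h))
    · simp [h]
    · exact mul_nonneg_of_nonpos_of_nonpos (by linarith [hxy l k h]) (by linarith [hst l k h])
  -- Twice the difference of the two sides is the sum over ordered pairs of products of minors.
  have expand : ∑ k ∈ T, ∑ l ∈ T, (x k * y l - x l * y k) * (s k * t l - s l * t k) =
      2 * ((∑ k ∈ T, x k * s k) * (∑ k ∈ T, y k * t k)
        - (∑ k ∈ T, y k * s k) * (∑ k ∈ T, x k * t k)) := by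
    have e : ∀ f g : ι → ℝ, (∑ k ∈ T, f k) * (∑ k ∈ T, g k) = ∑ k ∈ T, ∑ l ∈ T, f k * g l :=
      fun f g => sum_mul_sum ..
    have e' : ∀ f g : ι → ℝ, (∑ k ∈ T, f k) * (∑ k ∈ T, g k) = ∑ k ∈ T, ∑ l ∈ T, f l * g k :=
      fun f g => by rw [mul_comm, e]; simp_rw [mul_comm]
    rw [two_mul]
    nth_rewrite 1 [e, e]
    rw [e', e']
    simp only [← sum_sub_distrib, ← sum_add_distrib]
    exact sum_congr rfl fun k _ => sum_congr rfl fun l _ => by ring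
  linarith

/-- A nonnegative sequence on `ℤ` is log-concave without internal zeros, encoded by the four-point
inequality `p a * p d ≤ p b * p c` whenever `a + d = b + c` and `b`, `c` lie between `a` and `d`.
This single condition covers both log-concavity and the fact that the support is an interval. -/
structure LogConcaveSeq (p : ℤ → ℝ) : Prop where
  nonneg : ∀ i, 0 ≤ p i
  mul_le : ∀ {a b c d : ℤ}, a ≤ b → a ≤ c → a + d = b + c → p a * p d ≤ p b * p c

theorem LogConcaveSeq.of_adjacent {p : ℤ → ℝ} (h0 : ∀ i, 0 ≤ p i)
    (h : ∀ y z, y < z → p y * p (z + 1) ≤ p (y + 1) * p z) : LogConcaveSeq p := by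
  have main : ∀ k : ℕ, ∀ a c, a ≤ c → p a * p (c + k) ≤ p (a + k) * p c := by
    intro k
    induction k with
    | zero => intro a c _; simp
    | succ k ih =>
      intro a c hac
      rcases hac.eq_or_lt with rfl | hlt
      · rw [mul_comm]
      · have h1 := h a (c + k) (by omega)
        have h2 := ih (a + 1) c (by omega)
        push_cast
        rw [show c + ((k : ℤ) + 1) = c + k + 1 by ring, show a + ((k : ℤ) + 1) = a + 1 + k by ring]
        exact h1.trans h2
  refine ⟨h0, fun {a b c d} hab hac hd => ?_⟩
  have := main (b - a).toNat a c hac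
  have e : (((b - a).toNat : ℕ) : ℤ) = b - a := Int.toNat_of_nonneg (by omega)
  rw [e] at this
  rwa [show c + (b - a) = d by omega, show a + (b - a) = b by omega] at this

/-- The usual definition, log-concavity at adjacent points with interval support, implies the
four-point inequality. -/
theorem LogConcaveSeq.of_sq_of_ordConnected {p : ℤ → ℝ} (h0 : ∀ i, 0 ≤ p i)
    (hsq : ∀ j, p (j - 1) * p (j + 1) ≤ p j ^ 2) (hsupp : (Function.support p).OrdConnected) :
    LogConcaveSeq p := by
  refine .of_adjacent h0 fun y z hyz => ?_
  have main : ∀ k : ℕ, p y * p (y + k + 1) ≤ p (y + 1) * p (y + k) := by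
    intro k
    induction k with
    | zero => simp [mul_comm]
    | succ k ih =>
      rcases (h0 y).eq_or_lt with hy | hy
      · rw [← hy, zero_mul]; exact mul_nonneg (h0 _) (h0 _)
      push_cast
      rcases (h0 (y + (k + 1) + 1)).eq_or_lt with hz | hz
      · rw [← hz, mul_zero]; exact mul_nonneg (h0 _) (h0 _)
      have pos : ∀ i, y ≤ i → i ≤ y + (k + 1) + 1 → 0 < p i := fun i h1 h2 =>
        (h0 i).lt_of_ne' (hsupp.out hy.ne' hz.ne' ⟨h1, h2⟩)
      have p1 := pos (y + k) (by omega) (by omega)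
      have p2 := pos (y + k + 1) (by omega) (by omega)
      have hs := hsq (y + k + 1)
      rw [show y + (k : ℤ) + 1 - 1 = y + k by ring] at hs
      rw [show y + ((k : ℤ) + 1) = y + k + 1 by ring] at hz ⊢
      have h3 : p (y + k) * (p y * p (y + k + 1 + 1)) ≤ p y * p (y + k + 1) ^ 2 := by
        nlinarith
      have h4 : p y * p (y + k + 1) ^ 2 ≤ p (y + k) * (p (y + 1) * p (y + k + 1)) := by
        nlinarith
      exact le_of_mul_le_mul_left (h3.trans h4) p1
  have := main (z - y).toNat
  rwa [Int.toNat_of_nonneg (by omega), show y + (z - y) = z by omega] at this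

/-- Convolution of two sequences on `ℤ`, as a `tsum`; it is only used when `q` has finite support,
so that the junk value of a divergent sum plays no role. -/
noncomputable def conv (p q : ℤ → ℝ) (r : ℤ) : ℝ := ∑' j, p (r - j) * q j

theorem finite_support_conv {p q : ℤ → ℝ} (hp : (Function.support p).Finite)
    (hq : (Function.support q).Finite) : (Function.support (conv p q)).Finite := by
  refine (hp.image2 (· + ·) hq).subset fun r hr => ?_
  by_contra hcon
  refine hr ?_
  have : ∀ j, p (r - j) * q j = 0 := by
    intro j
    by_contra hj
    exact hcon ⟨r - j, left_ne_zero_of_mul hj, j, right_ne_zero_of_mul hj, by simp⟩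
  simp [conv, this]

theorem conv_symm {p q : ℤ → ℝ} {s t : ℤ} (hp : ∀ j, p (s - j) = p j) (hq : ∀ j, q (t - j) = q j)
    (r : ℤ) : conv p q (s + t - r) = conv p q r := by
  unfold conv
  rw [← (Equiv.subLeft t).tsum_eq]
  refine tsum_congr fun j => ?_
  simp only [Equiv.subLeft_apply]
  rw [hq, show s + t - r - (t - j) = s - (r - j) by ring, hp]

/-- Convolution preserves log-concavity: the relevant `2 × 2` minor of the Toeplitz matrix of the
convolution is given by Cauchy–Binet in terms of minors of the two factors. -/
theorem LogConcaveSeq.conv {p q : ℤ → ℝ} (hp : LogConcaveSeq p) (hq : LogConcaveSeq q)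
    (hqf : (Function.support q).Finite) : LogConcaveSeq (conv p q) := by
  refine .of_adjacent (fun i => tsum_nonneg fun j => mul_nonneg (hp.nonneg _) (hq.nonneg _)) ?_
  intro y z hyz
  set T : Finset ℤ := hqf.toFinset ∪ hqf.toFinset.image (· + 1)
  have h1 : ∀ r, LittlewoodOfford.conv p q r = ∑ k ∈ T, q k * p (r - k) := by
    intro r
    unfold LittlewoodOfford.conv
    rw [tsum_eq_sum (s := T)]
    · simp_rw [mul_comm]
    · intro b hb
      have : q b = 0 := by
        by_contra hne
        exact hb (by simp [T, hne])
      simp [this]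
  have h2 : ∀ r, LittlewoodOfford.conv p q r = ∑ k ∈ T, q (k - 1) * p (r + 1 - k) := by
    intro r
    unfold LittlewoodOfford.conv
    rw [← (Equiv.subRight (1 : ℤ)).tsum_eq, tsum_eq_sum (s := T)]
    · refine Finset.sum_congr rfl fun k _ => ?_
      simp only [Equiv.subRight_apply]
      rw [mul_comm, show r - (k - 1) = r + 1 - k by ring]
    · intro b hb
      have : q (b - 1) = 0 := by
        by_contra hne
        refine hb (Finset.mem_union_right _ (Finset.mem_image.2 ⟨b - 1, ?_, by ring⟩))
        simpa using hne
      simp [this]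
  rw [h2 y, h1 (z + 1), h1 (y + 1), h2 z]
  refine sum_mul_sum_le_of_minors T q (fun k => q (k - 1)) (fun k => p (y + 1 - k))
    (fun k => p (z + 1 - k)) ?_ ?_
  · intro k l hkl
    rw [mul_comm (q l)]
    exact hq.mul_le (by omega) (by omega) (by ring)
  · intro k l hkl
    exact hp.mul_le (by omega) (by omega) (by ring)

/-- Comparison of averages along a monotone lattice path. Think of `u` and `v` as the conditional
laws of the second coordinate `j` of a pair with independent log-concave integer coordinates, given
that the sum of the coordinates is `r`, respectively `r + 1`. By `h1` and `h2` the normalised `u`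
is carried to the normalised `v` by letting each `j` either stay or move to `j + 1`. If the value
`A` at each possible end point is at most the value `B` at the starting point, then the average
of `A` under `v` is at most the average of `B` under `u`. -/
theorem tsum_mul_tsum_le_of_interlacing {u v A B : ℤ → ℝ}
    (hu : (Function.support u).Finite) (hv : (Function.support v).Finite)
    (hu0 : ∀ j, 0 ≤ u j) (hv0 : ∀ j, 0 ≤ v j)
    (h1 : ∀ k l, k < l → u l * v k ≤ u k * v l)
    (h2 : ∀ k l, k < l → v (l + 1) * u k ≤ v (k + 1) * u l)
    (hAB : ∀ j, 0 < u j → 0 < v j → A j ≤ B j)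
    (hAB' : ∀ j, 0 < u j → 0 < v (j + 1) → A (j + 1) ≤ B j) :
    (∑' j, v j * A j) * (∑' j, u j) ≤ (∑' j, u j * B j) * (∑' j, v j) := by
  classical
  set T : Finset ℤ := hu.toFinset ∪ hv.toFinset ∪ hv.toFinset.image (· - 1) with hT
  have huT : ∀ j, j ∉ T → u j = 0 := by
    intro j hj; by_contra hne; exact hj (by simp [T, hne])
  have hvT : ∀ j, j ∉ T → v j = 0 := by
    intro j hj; by_contra hne; exact hj (by simp [T, hne])
  have hvT' : ∀ j, j ∉ T → v (j + 1) = 0 := by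
    intro j hj; by_contra hne
    exact hj (Finset.mem_union_right _ (Finset.mem_image.2 ⟨j + 1, by simpa using hne, by ring⟩))
  set N := ∑' j, u j with hN
  set N' := ∑' j, v j with hN'
  have eN : N = ∑ j ∈ T, u j := tsum_eq_sum fun j hj => huT j hj
  have eN' : N' = ∑ j ∈ T, v j := tsum_eq_sum fun j hj => hvT j hj
  have eN'' : N' = ∑ j ∈ T, v (j + 1) := by
    rw [hN', ← (Equiv.addRight (1 : ℤ)).tsum_eq]
    exact tsum_eq_sum fun j hj => hvT' j hj
  set e : ℤ → ℤ → ℝ := fun i k => if k ≤ i then 1 else 0 with he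
  have he' : ∀ i k l, k < l → e i l * 1 ≤ e i k * 1 := by
    intro i k l hkl
    simp only [he]; split_ifs <;> first | omega | norm_num
  set U : ℤ → ℝ := fun i => ∑ k ∈ T, u k * e i k with hU
  set V : ℤ → ℝ := fun i => ∑ k ∈ T, v k * e i k with hV
  have step : ∀ f : ℤ → ℝ, (∀ j, j ∉ T → f j = 0) → ∀ i,
      ∑ k ∈ T, f k * e i k = ∑ k ∈ T, f k * e (i - 1) k + f i := by
    intro f hf i
    have : f i = ∑ k ∈ T, if k = i then f k else 0 := by
      rw [Finset.sum_ite_eq']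
      split_ifs with h
      · rfl
      · exact hf i h
    rw [this, ← Finset.sum_add_distrib]
    refine Finset.sum_congr rfl fun k _ => ?_
    simp only [he]
    split_ifs <;> first | omega | simp
  have hUs := step u huT
  have hVs := step v hvT
  -- With `U`, `V` the partial sums of `u`, `v`, the mass moving from `j` to `j + 1` must be
  -- `α j = N' * U j - N * V j`, and the mass staying at `j` is `β j = N * V j - N' * U (j - 1)`.
  -- Both are nonnegative by comparison with the indicator of a half-line.
  have hα : ∀ i, 0 ≤ N' * U i - N * V i := by
    intro i
    have := sum_mul_sum_le_of_minors T u v (e i) (fun _ => 1) h1 (he' i)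
    simp only [mul_one] at this
    rw [← eN, ← eN'] at this
    change V i * N ≤ U i * N' at this
    linarith
  have hVshift : ∀ i, V i = ∑ k ∈ T, v (k + 1) * e (i - 1) k := by
    intro i
    have a1 : V i = ∑' k, v k * e i k := by
      rw [tsum_eq_sum (s := T)]; intro j hj; simp [hvT j hj]
    rw [a1, ← (Equiv.addRight (1 : ℤ)).tsum_eq, tsum_eq_sum (s := T)]
    · refine Finset.sum_congr rfl fun k _ => ?_
      simp only [Equiv.coe_addRight, he]
      congr 1
      by_cases h : k + 1 ≤ i
      · rw [if_pos h, if_pos (by omega)]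
      · rw [if_neg h, if_neg (by omega)]
    · intro j hj; simp [hvT' j hj]
  have hβ : ∀ i, 0 ≤ N * V i - N' * U (i - 1) := by
    intro i
    have := sum_mul_sum_le_of_minors T (fun k => v (k + 1)) u (e (i - 1)) (fun _ => 1) h2
      (he' (i - 1))
    simp only [mul_one] at this
    rw [← eN, ← eN'', ← hVshift] at this
    change U (i - 1) * N' ≤ V i * N at this
    linarith
  set α : ℤ → ℝ := fun i => N' * U i - N * V i with hαd
  set β : ℤ → ℝ := fun i => N * V i - N' * U (i - 1) with hβd
  have hab : ∀ i, α i + β i = N' * u i := by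
    intro i; simp only [hαd, hβd]; rw [show U i = U (i - 1) + u i from hUs i]; ring
  have hba : ∀ i, β (i + 1) + α i = N * v (i + 1) := by
    intro i
    have := hVs (i + 1)
    rw [show i + 1 - 1 = i by ring] at this
    simp only [hαd, hβd]
    rw [show V (i + 1) = V i + v (i + 1) from this, show i + 1 - 1 = i by ring]; ring
  have hN'0 : 0 ≤ N' := tsum_nonneg hv0
  have hN0 : 0 ≤ N := tsum_nonneg hu0
  have hαu : ∀ i, u i = 0 → α i = 0 ∧ β i = 0 := by
    intro i hi
    have h := hab i
    rw [hi, mul_zero] at h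
    have a := hα i; have b := hβ i
    constructor <;> linarith
  have hαv : ∀ i, v (i + 1) = 0 → α i = 0 := by
    intro i hi
    have h := hba i
    rw [hi, mul_zero] at h
    have a := hα i; have b := hβ (i + 1)
    linarith
  have hβv : ∀ i, v i = 0 → β i = 0 := by
    intro i hi
    have h := hba (i - 1)
    rw [show i - 1 + 1 = i by ring, hi, mul_zero] at h
    have a := hα (i - 1); have b := hβ i
    linarith
  have hsα : Summable fun j => α j * A (j + 1) :=
    summable_of_ne_finset_zero (s := T) fun j hj => by simp [(hαu j (huT j hj)).1]
  have hsβ : Summable fun j => β j * A j :=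
    summable_of_ne_finset_zero (s := T) fun j hj => by simp [(hαu j (huT j hj)).2]
  have e1 : (∑' j, v j * A j) * N = ∑' j, (β j * A j + α j * A (j + 1)) := by
    rw [hsβ.tsum_add hsα, ← (Equiv.subRight (1 : ℤ)).tsum_eq (fun j => α j * A (j + 1))]
    have hs' : Summable fun j : ℤ => α ((Equiv.subRight (1 : ℤ)) j) *
        A ((Equiv.subRight (1 : ℤ)) j + 1) := (Equiv.subRight (1 : ℤ)).summable_iff.2 hsα
    rw [← hsβ.tsum_add hs', ← tsum_mul_right]
    refine tsum_congr fun j => ?_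
    have h := hba (j - 1)
    rw [show j - 1 + 1 = j by ring] at h
    simp only [Equiv.subRight_apply]
    rw [show j - 1 + 1 = j by ring]
    linear_combination -(A j) * h
  have e2 : (∑' j, u j * B j) * N' = ∑' j, (β j * B j + α j * B j) := by
    rw [← tsum_mul_right]
    refine tsum_congr fun j => ?_
    linear_combination -(B j) * hab j
  rw [e1, e2]
  refine (hsβ.add hsα).tsum_le_tsum (fun j => ?_) (summable_of_ne_finset_zero (s := T) fun j hj =>
    by simp [(hαu j (huT j hj)).1, (hαu j (huT j hj)).2])
  rcases (hu0 j).eq_or_lt with h | h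
  · simp [(hαu j h.symm).1, (hαu j h.symm).2]
  refine add_le_add ?_ ?_
  · rcases (hv0 j).eq_or_lt with h' | h'
    · simp [hβv j h'.symm]
    · exact mul_le_mul_of_nonneg_left (hAB j h h') (hβ j)
  · rcases (hv0 (j + 1)).eq_or_lt with h' | h'
    · simp [hαv j h'.symm]
    · exact mul_le_mul_of_nonneg_left (hAB' j h h') (hα j)

/-! ### Moments of log-concave sequences on a half-line -/

section Moments

open Finset

theorem sum_mul_tail (N : ℕ) (c h : ℕ → ℝ) (hN : ∀ i, N ≤ i → h i = 0) :
    ∑ j ∈ range N, c j * ∑ i ∈ range N, h (i + j) =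
      ∑ k ∈ range N, (∑ j ∈ range (k + 1), c j) * h k := by
  have h1 : ∀ j ∈ range N, ∑ i ∈ range N, h (i + j) =
      ∑ k ∈ range N, if j ≤ k then h k else 0 := by
    intro j _
    rw [← sum_filter]
    symm
    apply sum_bij_ne_zero (fun k _ _ => k - j)
    · intro k hk _
      simp only [mem_filter, mem_range] at hk ⊢; omega
    · intro a ha _ b hb _ hab
      simp only [mem_filter, mem_range] at ha hb; omega
    · intro i hi hne
      have hlt : i + j < N := by
        by_contra hcon; exact hne (hN _ (by omega))
      exact ⟨i + j, by simp [hlt], hne, by omega⟩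
    · intro k hk _
      simp only [mem_filter, mem_range] at hk
      congr 1; omega
  rw [sum_congr rfl fun j hj => by rw [h1 j hj]]
  simp_rw [mul_sum, sum_mul]
  rw [sum_comm]
  refine sum_congr rfl fun k hk => ?_
  rw [← sum_subset (s₁ := range (k + 1)) (s₂ := range N)]
  · refine sum_congr rfl fun j hj => ?_
    rw [if_pos (by simp only [mem_range] at hj; omega)]
  · intro j hj; simp only [mem_range] at *; omega
  · intro j _ hj
    rw [if_neg (by simp only [mem_range] at hj; omega), mul_zero]

/-- The weighted sum on the left is the sum over `j` of the tail sums of `h` from `j` on, so the claim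
follows by summing the hypothesis `hsub`. Equality holds for geometric sequences. -/
theorem head_mul_sum_tail_le (N : ℕ) (h : ℕ → ℝ) (hN : ∀ i, N ≤ i → h i = 0)
    (hsub : ∀ j k, h 0 * h (j + k) ≤ h j * h k) :
    h 0 * ∑ k ∈ range N, (k + 1 : ℝ) * h k ≤ (∑ k ∈ range N, h k) ^ 2 := by
  have e := sum_mul_tail N (fun _ => 1) h hN
  simp only [one_mul, sum_const, card_range, nsmul_eq_mul, mul_one] at e
  push_cast at e
  rw [← e, sq, sum_mul_sum, mul_sum]
  refine sum_le_sum fun j _ => ?_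
  rw [mul_sum]
  refine sum_le_sum fun i _ => ?_
  rw [add_comm i j]
  exact hsub j i

/-- Let `a₁`, `a₂`, `a₃` be the first three iterated tail sums at `0` of a log-concave sequence `f` on
`ℕ`. Then `f 0 * a₂ ≤ a₁ ^ 2` and `a₁ * a₃ ≤ a₂ ^ 2`, with equality for geometric sequences. The
second inequality is the first one for the sequence of tails, which is again log-concave. -/
theorem half_line_moments (N : ℕ) (f : ℕ → ℝ) (hN : ∀ i, N ≤ i → f i = 0)
    (hlc : ∀ a b c d, a ≤ b → a ≤ c → a + d = b + c → f a * f d ≤ f b * f c) :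
    f 0 * (∑ k ∈ range N, (k + 1 : ℝ) * f k) ≤ (∑ k ∈ range N, f k) ^ 2 ∧
    (∑ k ∈ range N, f k) * (∑ k ∈ range N, (k + 1 : ℝ) * (k + 2) / 2 * f k) ≤
      (∑ k ∈ range N, (k + 1 : ℝ) * f k) ^ 2 := by
  refine ⟨head_mul_sum_tail_le N f hN fun j k => hlc 0 j k (j + k) (by omega) (by omega)
    (by omega), ?_⟩
  set F : ℕ → ℝ := fun j => ∑ i ∈ range N, f (i + j) with hF
  have hF0 : ∀ i, N ≤ i → F i = 0 := fun i hi => sum_eq_zero fun k _ => hN _ (by omega)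
  have hFt : ∀ j k, F (j + k) = ∑ i ∈ range N, f (i + j) * if k ≤ i then 1 else 0 := by
    intro j k
    by_cases hk : N ≤ k
    · rw [hF0 _ (by omega)]
      exact (sum_eq_zero fun i hi => by
        rw [if_neg (by simp only [mem_range] at hi; omega), mul_zero]).symm
    obtain ⟨M, hM⟩ := Nat.exists_eq_add_of_le (not_le.1 hk).le
    have e1 : F (j + k) = ∑ i ∈ range M, f (i + (j + k)) := by
      symm
      refine sum_subset (range_subset_range.2 (by omega)) fun i _ hi => hN _ ?_
      simp only [mem_range] at hi; omega
    rw [e1, hM, sum_range_add, sum_eq_zero (s := range k), zero_add]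
    · refine sum_congr rfl fun i _ => ?_
      rw [if_pos (by omega), mul_one]
      congr 1; omega
    · intro i hi
      rw [if_neg (by simp only [mem_range] at hi; omega), mul_zero]
  have hsub : ∀ j k, F 0 * F (j + k) ≤ F j * F k := by
    intro j k
    have := sum_mul_sum_le_of_minors (range N) (fun i => f (i + j)) f (fun _ => 1)
      (fun i => if k ≤ i then (1 : ℝ) else 0) ?_ ?_
    · have e0 := hFt 0 k
      simp only [zero_add, add_zero] at e0
      rw [hFt j k, e0]
      simpa [hF] using this
    · intro a b hab
      rw [mul_comm]
      exact (hlc a (a + j) b (b + j) (by omega) (by omega) (by omega))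
    · intro a b hab
      split_ifs <;> first | omega | norm_num
  have h := head_mul_sum_tail_le N F hF0 hsub
  have e1 := sum_mul_tail N (fun _ => 1) f hN
  have e2 := sum_mul_tail N (fun j => (j + 1 : ℝ)) f hN
  simp only [one_mul, sum_const, card_range, nsmul_eq_mul, mul_one] at e1
  push_cast at e1
  have hg : ∀ k : ℕ, ∑ j ∈ range (k + 1), ((j : ℝ) + 1) = (k + 1) * (k + 2) / 2 := by
    intro k
    induction k with
    | zero => simp
    | succ k ih => rw [sum_range_succ, ih]; push_cast; ring
  simp_rw [hg] at e2
  change ∑ j ∈ range N, (j + 1 : ℝ) * F j = _ at e2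
  change ∑ j ∈ range N, F j = _ at e1
  rw [e1, e2] at h
  simpa [hF] using h

/-- Bounds for the first two moments of a log-concave sequence on `ℕ` in terms of its mass `a` and
its value `M` at `0`: the first moment is parametrised as `a * p / M`, where `p = a - M` is the
geometric case. -/
theorem half_line_moments_le (N : ℕ) (f : ℕ → ℝ) (h0 : ∀ i, 0 ≤ f i) (hN : ∀ i, N ≤ i → f i = 0)
    (hlc : ∀ a b c d, a ≤ b → a ≤ c → a + d = b + c → f a * f d ≤ f b * f c) (hpos : 0 < f 0) :
    ∃ p, 0 ≤ p ∧ p ≤ (∑ k ∈ range N, f k) - f 0 ∧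
      f 0 * (∑ k ∈ range N, (k : ℝ) * f k) = (∑ k ∈ range N, f k) * p ∧
      f 0 ^ 2 * (∑ k ∈ range N, (k : ℝ) ^ 2 * f k) ≤
        (∑ k ∈ range N, f k) * (f 0 * p + 2 * p ^ 2) := by
  obtain ⟨h1, h2⟩ := half_line_moments N f hN hlc
  have e2 : ∑ k ∈ range N, (k + 1 : ℝ) * f k =
      ∑ k ∈ range N, (k : ℝ) * f k + ∑ k ∈ range N, f k := by
    rw [← sum_add_distrib]; exact sum_congr rfl fun k _ => by ring
  have e3 : ∑ k ∈ range N, (k + 1 : ℝ) * (k + 2) / 2 * f k =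
      (∑ k ∈ range N, (k : ℝ) ^ 2 * f k + 3 * ∑ k ∈ range N, (k : ℝ) * f k) / 2
        + ∑ k ∈ range N, f k := by
    rw [mul_sum, ← sum_add_distrib, sum_div, ← sum_add_distrib]
    exact sum_congr rfl fun k _ => by ring
  have hge : f 0 ≤ ∑ k ∈ range N, f k := by
    refine single_le_sum (f := f) (fun i _ => h0 i) (mem_range.2 ?_)
    by_contra hcon
    exact hpos.ne' (hN 0 (by omega))
  have hA0 : 0 ≤ ∑ k ∈ range N, (k : ℝ) * f k :=
    sum_nonneg fun k _ => mul_nonneg k.cast_nonneg (h0 k)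
  rw [e2] at h1 h2
  rw [e3] at h2
  set M := f 0
  set a := ∑ k ∈ range N, f k
  set A := ∑ k ∈ range N, (k : ℝ) * f k
  set B := ∑ k ∈ range N, (k : ℝ) ^ 2 * f k
  have ha : 0 < a := hpos.trans_le hge
  have hp : a * (M * A / a) = M * A := by field_simp
  refine ⟨M * A / a, by positivity, ?_, hp.symm, ?_⟩
  · rw [div_le_iff₀ ha]; nlinarith
  · generalize M * A / a = p at hp
    refine le_of_mul_le_mul_left ?_ ha
    have h3 : a * B ≤ a * A + 2 * A ^ 2 := by nlinarith
    calc a * (M ^ 2 * B) = M ^ 2 * (a * B) := by ring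
      _ ≤ M ^ 2 * (a * A + 2 * A ^ 2) := by gcongr
      _ = M * a * (M * A) + 2 * (M * A) ^ 2 := by ring
      _ = a * (a * (M * p + 2 * p ^ 2)) := by rw [← hp]; ring

theorem LogConcaveSeq.right {f : ℤ → ℝ} (hf : LogConcaveSeq f) (m : ℤ) (a b c d : ℕ) (h1 : a ≤ b)
    (h2 : a ≤ c) (h3 : a + d = b + c) : f (m + a) * f (m + d) ≤ f (m + b) * f (m + c) :=
  hf.mul_le (by omega) (by omega) (by omega)

theorem LogConcaveSeq.left {f : ℤ → ℝ} (hf : LogConcaveSeq f) (m : ℤ) (a b c d : ℕ) (h1 : a ≤ b)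
    (h2 : a ≤ c) (h3 : a + d = b + c) : f (m - a) * f (m - d) ≤ f (m - b) * f (m - c) := by
  rw [mul_comm]
  exact hf.mul_le (by omega) (by omega) (by omega)

theorem exists_nat_bound {f : ℤ → ℝ} (hf : (Function.support f).Finite) (m : ℤ) :
    ∃ N : ℕ, ∀ j : ℤ, N ≤ |j - m| → f j = 0 := by
  obtain ⟨N, hN⟩ := (hf.image fun j => (j - m).natAbs).bddAbove
  refine ⟨N + 1, fun j hj => ?_⟩
  by_contra hne
  have := hN ⟨j, hne, rfl⟩
  rw [Int.abs_eq_natAbs] at hj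
  simp only at this
  omega

theorem tsum_eq_sum_add_sum {g : ℤ → ℝ} {N : ℕ} {m : ℤ} (h : ∀ j : ℤ, N ≤ |j - m| → g j = 0) :
    ∑' j, g j = ∑ n ∈ range N, g (m + n) + ∑ n ∈ range N, g (m - 1 - n) := by
  rw [← (Equiv.addLeft m).tsum_eq]
  have hs1 : ∀ n : ℕ, n ∉ range N → g (m + n) = 0 := fun n hn => h _ (by
    simp only [mem_range] at hn; rw [le_abs]; left; omega)
  have hs2 : ∀ n : ℕ, n ∉ range N → g (m - 1 - n) = 0 := fun n hn => h _ (by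
    simp only [mem_range] at hn; rw [le_abs]; right; omega)
  have e : ∀ n : ℕ, g (Equiv.addLeft m (-((n : ℤ) + 1))) = g (m - 1 - n) := fun n => by
    simp only [Equiv.coe_addLeft]; congr 1; ring
  rw [tsum_of_nat_of_neg_add_one]
  · simp_rw [e, Equiv.coe_addLeft]
    rw [tsum_eq_sum hs1, tsum_eq_sum hs2]
  · exact summable_of_ne_finset_zero hs1
  · simp_rw [e]; exact summable_of_ne_finset_zero hs2

theorem tsum_eq_sum_add_sum_sub {g : ℤ → ℝ} {N : ℕ} {m : ℤ}
    (h : ∀ j : ℤ, N ≤ |j - m| → g j = 0) :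
    ∑' j, g j = ∑ n ∈ range N, g (m + n) + ∑ n ∈ range N, g (m - n) - g m := by
  rw [tsum_eq_sum_add_sum h, add_sub_assoc]
  congr 1
  have h1 := sum_range_succ' (fun n : ℕ => g (m - n)) N
  rw [sum_range_succ, h (m - N) (by rw [le_abs]; right; omega)] at h1
  simp only [Nat.cast_zero, sub_zero, add_zero] at h1
  rw [h1, add_sub_cancel_right]
  refine sum_congr rfl fun n _ => ?_
  congr 1; push_cast; ring

/-- A log-concave probability sequence `f` satisfies `f m ^ 2 * (1 + Var) ≤ 1` at every point `m`.
The half-line bounds on both sides of `m` leave a function of two parameters `p`, `q`, which is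
largest when both one-sided sequences are geometric. -/
theorem LogConcaveSeq.sq_mul_variance_le {f : ℤ → ℝ} (hf : LogConcaveSeq f)
    (hfin : (Function.support f).Finite) (hsum : ∑' j, f j = 1) (m : ℤ) :
    f m ^ 2 * (1 + ((∑' j : ℤ, ((j : ℝ) - m) ^ 2 * f j) - (∑' j : ℤ, ((j : ℝ) - m) * f j) ^ 2))
      ≤ 1 := by
  rcases (hf.nonneg m).eq_or_lt with h0 | hpos
  · rw [← h0]; norm_num
  obtain ⟨N, hN⟩ := exists_nat_bound hfin m
  have hr : ∀ i : ℕ, N ≤ i → f (m + i) = 0 := fun i hi => hN _ (by rw [le_abs]; left; omega)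
  have hl : ∀ i : ℕ, N ≤ i → f (m - i) = 0 := fun i hi => hN _ (by rw [le_abs]; right; omega)
  obtain ⟨p, hp0, hp1, hp2, hp3⟩ := half_line_moments_le N (fun n => f (m + n))
    (fun _ => hf.nonneg _) hr (hf.right m) (by simpa using hpos)
  obtain ⟨q, hq0, hq1, hq2, hq3⟩ := half_line_moments_le N (fun n => f (m - n))
    (fun _ => hf.nonneg _) hl (hf.left m) (by simpa using hpos)
  rw [tsum_eq_sum_add_sum_sub hN] at hsum
  rw [tsum_eq_sum_add_sum_sub (fun j hj => by rw [hN j hj, mul_zero]),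
    tsum_eq_sum_add_sum_sub (fun j hj => by rw [hN j hj, mul_zero])]
  simp only [Int.cast_add, Int.cast_sub, Int.cast_natCast, add_sub_cancel_left, sub_sub_cancel_left,
    sub_self, neg_mul, sum_neg_distrib, neg_sq, Nat.cast_zero, add_zero, sub_zero, zero_mul, ne_eq,
    OfNat.ofNat_ne_zero, not_false_eq_true, zero_pow] at *
  generalize f m = M at *
  generalize ∑ n ∈ range N, f (m + n) = α at *
  generalize ∑ n ∈ range N, f (m - n) = β at *
  generalize ∑ n ∈ range N, (n : ℝ) * f (m + n) = A at *
  generalize ∑ n ∈ range N, (n : ℝ) * f (m - n) = B at *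
  generalize ∑ n ∈ range N, (n : ℝ) ^ 2 * f (m + n) = A₂ at *
  generalize ∑ n ∈ range N, (n : ℝ) ^ 2 * f (m - n) = B₂ at *
  obtain ⟨a, rfl⟩ : ∃ a, β = 1 - a := ⟨1 - β, by ring⟩
  obtain ⟨b, rfl⟩ : ∃ b, α = 1 - b := ⟨1 - α, by ring⟩
  obtain rfl : M = 1 - a - b := by linarith
  have hpa : p ≤ a := by linarith
  have hqb : q ≤ b := by linarith
  have ha0 : 0 ≤ a := hp0.trans hpa
  have hb0 : 0 ≤ b := hq0.trans hqb
  have e : (1 - a - b) ^ 2 * (1 + (A₂ + B₂ - (A + -B) ^ 2)) =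
      (1 - a - b) ^ 2 + (1 - a - b) ^ 2 * A₂ + (1 - a - b) ^ 2 * B₂ -
        ((1 - b) * p - (1 - a) * q) ^ 2 := by
    rw [← hp2, ← hq2]; ring
  -- After `p ^ 2 ≤ a * p` and `q ^ 2 ≤ b * q` the bound is increasing in `p` and `q`, so the extreme
  -- values `p = a`, `q = b` can be inserted.
  have hp4 : (1 - b) * (1 + b) * (p * p) ≤ (1 - b) * (1 + b) * (a * p) := by
    have : 0 ≤ (1 - b) * (1 + b) := mul_nonneg (by linarith) (by linarith)
    gcongr
  have hq4 : (1 - a) * (1 + a) * (q * q) ≤ (1 - a) * (1 + a) * (b * q) := by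
    have : 0 ≤ (1 - a) * (1 + a) := mul_nonneg (by linarith) (by linarith)
    gcongr
  have hp5 : (1 - b) * (1 - a - b + (1 + b) * a) * p ≤ (1 - b) * (1 - a - b + (1 + b) * a) * a := by
    have : 0 ≤ (1 - b) * (1 - a - b + (1 + b) * a) := mul_nonneg (by linarith) (by nlinarith)
    gcongr
  have hq5 : (1 - a) * (1 - a - b + (1 + a) * b) * q ≤ (1 - a) * (1 - a - b + (1 + a) * b) * b := by
    have : 0 ≤ (1 - a) * (1 - a - b + (1 + a) * b) := mul_nonneg (by linarith) (by nlinarith)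
    gcongr
  have hpq : (1 - a) * (1 - b) * (p * q) ≤ (1 - a) * (1 - b) * (a * b) := by
    have : 0 ≤ (1 - a) * (1 - b) := mul_nonneg (by linarith) (by linarith)
    gcongr
  have hs : 0 ≤ (a + b) * (1 - a - b) := mul_nonneg (by linarith) hpos.le
  have hab : 0 ≤ a * b := mul_nonneg ha0 hb0
  rw [e]
  linarith

/-- Symmetry about an integer `m`; equality holds for the two-sided geometric sequence. -/
theorem LogConcaveSeq.sq_mul_second_moment_le_of_symm {f : ℤ → ℝ} (hf : LogConcaveSeq f)
    (hfin : (Function.support f).Finite) (hsum : ∑' j, f j = 1) (m : ℤ)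
    (hsymm : ∀ j, f (2 * m - j) = f j) :
    f m ^ 2 * (1 + 2 * ∑' j : ℤ, ((j : ℝ) - m) ^ 2 * f j) ≤ 1 := by
  rcases (hf.nonneg m).eq_or_lt with h0 | hpos
  · rw [← h0]; norm_num
  obtain ⟨N, hN⟩ := exists_nat_bound hfin m
  have hr : ∀ i : ℕ, N ≤ i → f (m + i) = 0 := fun i hi => hN _ (by rw [le_abs]; left; omega)
  obtain ⟨p, hp0, hp1, hp2, hp3⟩ := half_line_moments_le N (fun n => f (m + n))
    (fun _ => hf.nonneg _) hr (hf.right m) (by simpa using hpos)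
  have hs : ∀ n : ℕ, f (m - n) = f (m + n) := fun n => by
    rw [← hsymm]; congr 1; ring
  rw [tsum_eq_sum_add_sum_sub hN] at hsum
  rw [tsum_eq_sum_add_sum_sub (fun j hj => by rw [hN j hj, mul_zero])]
  simp only [Int.cast_add, Int.cast_sub, Int.cast_natCast, add_sub_cancel_left, sub_sub_cancel_left,
    sub_self, neg_sq, Nat.cast_zero, add_zero, sub_zero, zero_mul, ne_eq,
    OfNat.ofNat_ne_zero, not_false_eq_true, zero_pow, hs] at *
  generalize f m = M at *
  generalize ∑ n ∈ range N, f (m + n) = α at *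
  generalize ∑ n ∈ range N, (n : ℝ) ^ 2 * f (m + n) = A₂ at *
  obtain rfl : M = 2 * α - 1 := by linarith
  have h4 : α * ((2 * α - 1) * p + 2 * p ^ 2) ≤
      α * ((2 * α - 1) * (1 - α) + 2 * (1 - α) ^ 2) := by
    have : p ≤ 1 - α := by linarith
    have : 0 ≤ α := by linarith
    gcongr
  linarith

/-- Symmetry about the half-integer `m - 1 / 2`: each of the half-lines `{m, m + 1, …}` and
`{…, m - 1}` carries mass `1 / 2`. -/
theorem LogConcaveSeq.sq_mul_second_moment_le_of_symm_half {f : ℤ → ℝ} (hf : LogConcaveSeq f)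
    (hfin : (Function.support f).Finite) (hsum : ∑' j, f j = 1) (m : ℤ)
    (hsymm : ∀ j, f (2 * m - 1 - j) = f j) :
    f m ^ 2 * (1 + 2 * ∑' j : ℤ, ((j : ℝ) - (m - 1 / 2)) ^ 2 * f j) ≤ 1 := by
  rcases (hf.nonneg m).eq_or_lt with h0 | hpos
  · rw [← h0]; norm_num
  obtain ⟨N, hN⟩ := exists_nat_bound hfin m
  have hr : ∀ i : ℕ, N ≤ i → f (m + i) = 0 := fun i hi => hN _ (by rw [le_abs]; left; omega)
  obtain ⟨p, hp0, hp1, hp2, hp3⟩ := half_line_moments_le N (fun n => f (m + n))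
    (fun _ => hf.nonneg _) hr (hf.right m) (by simpa using hpos)
  have hs : ∀ n : ℕ, f (m - 1 - n) = f (m + n) := fun n => by
    rw [← hsymm]; congr 1; ring
  rw [tsum_eq_sum_add_sum hN] at hsum
  rw [tsum_eq_sum_add_sum (fun j hj => by rw [hN j hj, mul_zero])]
  simp only [hs] at *
  have e1 : ∀ n : ℕ, (((m + n : ℤ) : ℝ) - (m - 1 / 2)) ^ 2 * f (m + n) =
      (n : ℝ) ^ 2 * f (m + n) + n * f (m + n) + 1 / 4 * f (m + n) := fun n => by
    push_cast; ring
  have e2 : ∀ n : ℕ, (((m - 1 - n : ℤ) : ℝ) - (m - 1 / 2)) ^ 2 * f (m + n) =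
      (n : ℝ) ^ 2 * f (m + n) + n * f (m + n) + 1 / 4 * f (m + n) := fun n => by
    push_cast; ring
  simp only [e1, e2, sum_add_distrib, ← mul_sum, Nat.cast_zero, add_zero] at *
  generalize f m = M at *
  generalize ∑ n ∈ range N, f (m + n) = α at *
  generalize ∑ n ∈ range N, (n : ℝ) * f (m + n) = A at *
  generalize ∑ n ∈ range N, (n : ℝ) ^ 2 * f (m + n) = A₂ at *
  obtain rfl : α = 1 / 2 := by linarith
  have h4 : M * p + p ^ 2 ≤ M * (1 / 2 - M) + (1 / 2 - M) ^ 2 := by gcongr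
  have h5 : M ^ 2 * A = M * (M * A) := by ring
  rw [hp2] at h5
  nlinarith

/-- For a log-concave probability sequence symmetric about `t / 2`, the bound with constant `2` at
the centre passes to every point `r`, since the sequence is largest at the centre. -/
theorem LogConcaveSeq.sq_mul_le_of_symm {f : ℤ → ℝ} (hf : LogConcaveSeq f)
    (hfin : (Function.support f).Finite) (hsum : ∑' j, f j = 1) (t : ℤ)
    (hsymm : ∀ j, f (t - j) = f j) (r : ℤ) :
    f r ^ 2 * (1 + 2 * ∑' j : ℤ, ((j : ℝ) - t / 2) ^ 2 * f j) ≤ 1 := by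
  have hE : 0 ≤ ∑' j : ℤ, ((j : ℝ) - t / 2) ^ 2 * f j :=
    tsum_nonneg fun j => mul_nonneg (sq_nonneg _) (hf.nonneg j)
  rcases Int.even_or_odd' t with ⟨m, rfl | rfl⟩
  · have h1 := hf.sq_mul_second_moment_le_of_symm hfin hsum m hsymm
    have h2 : f r ^ 2 ≤ f m ^ 2 := by
      rcases le_total r m with h | h
      · have := hf.mul_le (a := r) (b := m) (c := m) (d := 2 * m - r) h h (by ring)
        rw [hsymm] at this; nlinarith
      · have := hf.mul_le (a := 2 * m - r) (b := m) (c := m) (d := r) (by omega) (by omega) (by ring)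
        rw [hsymm] at this; nlinarith
    push_cast at hE ⊢
    simp only [mul_div_cancel_left₀ (m : ℝ) (two_ne_zero)] at hE ⊢
    exact (mul_le_mul_of_nonneg_right h2 (by positivity)).trans h1
  · have h1 := hf.sq_mul_second_moment_le_of_symm_half hfin hsum (m + 1)
      (fun j => by rw [← hsymm]; congr 1; ring)
    have e : f (m + 1) = f m := by rw [← hsymm m]; congr 1; ring
    have h2 : f r ^ 2 ≤ f (m + 1) ^ 2 := by
      rcases le_or_gt r m with h | h
      · have := hf.mul_le (a := r) (b := m) (c := m + 1) (d := 2 * m + 1 - r) h (by omega) (by ring)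
        rw [hsymm, e] at this; rw [e]; nlinarith
      · have := hf.mul_le (a := 2 * m + 1 - r) (b := m) (c := m + 1) (d := r) (by omega) (by omega)
          (by ring)
        rw [hsymm, e] at this; rw [e]; nlinarith
    have e2 : ∀ j : ℤ, ((j : ℝ) - ((m + 1 : ℤ) - 1 / 2)) = (j : ℝ) - (2 * m + 1 : ℤ) / 2 := by
      intro j; push_cast; ring
    simp only [e2] at h1
    exact (mul_le_mul_of_nonneg_right h2 (by positivity)).trans h1

end Moments

/-! ### Laws of integer-valued random variables -/

theorem pmf_nonneg {Ω : Type*} [MeasurableSpace Ω] {P : Measure Ω} (X : Ω → ℤ) (j : ℤ) :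
    0 ≤ pmf P X j := measureReal_nonneg

theorem IsDiscreteLogConcave.logConcaveSeq {Ω : Type*} [MeasurableSpace Ω] {P : Measure Ω}
    {X : Ω → ℤ} (h : IsDiscreteLogConcave P X) : LogConcaveSeq (pmf P X) :=
  .of_sq_of_ordConnected (pmf_nonneg X) h.1 h.2

section Pmf

variable {Ω : Type*} [MeasurableSpace Ω] {P : Measure Ω} [IsProbabilityMeasure P]

theorem measureReal_eq_tsum {X : Ω → ℤ} (hX : Measurable X) {E : Set Ω} (hE : MeasurableSet E) :
    P.real E = ∑' j, P.real (E ∩ {ω | X ω = j}) := by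
  have h := measure_iUnion (μ := P) (f := fun j => E ∩ {ω | X ω = j})
    (fun i j hij => Set.disjoint_left.2 fun ω h1 h2 => hij (h1.2.symm.trans h2.2))
    (fun j => hE.inter (hX (measurableSet_singleton j)))
  rw [← Set.inter_iUnion, show ⋃ j, {ω | X ω = j} = Set.univ from
    Set.eq_univ_of_forall fun ω => Set.mem_iUnion.2 ⟨X ω, rfl⟩, Set.inter_univ] at h
  rw [Measure.real, h, ENNReal.tsum_toReal_eq fun _ => measure_ne_top _ _]
  rfl

theorem tsum_pmf {X : Ω → ℤ} (hX : Measurable X) : ∑' j, pmf P X j = 1 := by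
  have := measureReal_eq_tsum (P := P) hX MeasurableSet.univ
  simpa [pmf] using this.symm

theorem measureReal_indep {α : Type*} [MeasurableSpace α] {Y : Ω → α} {X : Ω → ℤ}
    (hY : Measurable Y) (hX : Measurable X) (hind : IndepFun Y X P) {C : ℤ → Set α}
    (hC : ∀ j, MeasurableSet (C j)) :
    P.real {ω | Y ω ∈ C (X ω)} = ∑' j, P.real {ω | Y ω ∈ C j} * pmf P X j := by
  have hE : MeasurableSet {ω | Y ω ∈ C (X ω)} := by
    have : {ω | Y ω ∈ C (X ω)} = ⋃ j, Y ⁻¹' C j ∩ X ⁻¹' {j} := by ext; simp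
    rw [this]
    exact .iUnion fun j => (hY (hC j)).inter (hX (measurableSet_singleton j))
  rw [measureReal_eq_tsum hX hE]
  refine tsum_congr fun j => ?_
  have : {ω | Y ω ∈ C (X ω)} ∩ {ω | X ω = j} = Y ⁻¹' C j ∩ X ⁻¹' {j} := by
    ext ω
    simp only [Set.mem_inter_iff, Set.mem_ofPred_eq, Set.mem_preimage, Set.mem_singleton_iff]
    constructor <;> rintro ⟨h1, rfl⟩ <;> exact ⟨h1, rfl⟩
  rw [this, Measure.real, hind.measure_inter_preimage_eq_mul _ _ (hC j)
    (measurableSet_singleton j), ENNReal.toReal_mul]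
  rfl

theorem pmf_add {S X : Ω → ℤ} (hS : Measurable S) (hX : Measurable X) (hind : IndepFun S X P) :
    pmf P (fun ω => S ω + X ω) = conv (pmf P S) (pmf P X) := by
  ext r
  have := measureReal_indep hS hX hind (C := fun j => {r - j}) fun j => measurableSet_singleton _
  simp only [Set.mem_singleton_iff, eq_sub_iff_add_eq] at this
  rw [pmf, this]
  refine tsum_congr fun j => ?_
  simp only [pmf, eq_sub_iff_add_eq]

theorem memLp_comp {S : Ω → ℤ} (hS : Measurable S) (hfin : IsFinitelySupported P S) (g : ℤ → ℝ)
    (p : ENNReal) : MemLp (fun ω => g (S ω)) p P := by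
  obtain ⟨C, hC⟩ := (hfin.image fun j => ‖g j‖).bddAbove
  refine MemLp.of_bound ((measurable_of_countable g).comp hS).aestronglyMeasurable C ?_
  have : ∀ᵐ ω ∂P, ∀ j, j ∉ Function.support (pmf P S) → S ω ≠ j := by
    refine ae_all_iff.2 fun j => ?_
    by_cases hj : pmf P S j = 0
    · have h0 : P {ω | S ω = j} = 0 := (measureReal_eq_zero_iff).1 hj
      filter_upwards [measure_eq_zero_iff_ae_notMem.1 h0] with ω hω _ using hω
    · exact .of_forall fun ω h => absurd hj h
  filter_upwards [this] with ω hω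
  refine hC ⟨S ω, ?_, rfl⟩
  by_contra hcon
  exact hω _ hcon rfl

theorem integral_comp_eq_tsum {S : Ω → ℤ} (hS : Measurable S) (hfin : IsFinitelySupported P S)
    (g : ℤ → ℝ) : ∫ ω, g (S ω) ∂P = ∑' j, g j * pmf P S j := by
  have hg : Measurable g := measurable_of_countable g
  have hint : Integrable g (P.map S) :=
    (integrable_map_measure hg.aestronglyMeasurable hS.aemeasurable).2
      ((memLp_comp hS hfin g 1).integrable le_rfl)
  rw [← integral_map hS.aemeasurable hg.aestronglyMeasurable, integral_countable hint]
  refine tsum_congr fun j => ?_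
  rw [map_measureReal_apply hS (measurableSet_singleton j), smul_eq_mul, mul_comm]
  rfl

theorem sq_pmf_mul_variance_le {S : Ω → ℤ} (hS : Measurable S) (hfin : IsFinitelySupported P S)
    (hlc : LogConcaveSeq (pmf P S)) (r : ℤ) :
    pmf P S r ^ 2 * (1 + variance (fun ω => (S ω : ℝ)) P) ≤ 1 := by
  have h := hlc.sq_mul_variance_le hfin (tsum_pmf hS) r
  rw [← integral_comp_eq_tsum hS hfin fun j => ((j : ℝ) - r) ^ 2,
    ← integral_comp_eq_tsum hS hfin fun j => ((j : ℝ) - r)] at h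
  rwa [← variance_sub_const (memLp_comp hS hfin (fun j => (j : ℝ)) 2).aestronglyMeasurable (r : ℝ),
    variance_eq_sub (memLp_comp hS hfin (fun j => (j : ℝ) - r) 2)]

theorem sq_pmf_mul_variance_le_of_symm {S : Ω → ℤ} (hS : Measurable S)
    (hfin : IsFinitelySupported P S) (hlc : LogConcaveSeq (pmf P S))
    {t : ℤ} (ht : ∀ j, pmf P S (t - j) = pmf P S j) (r : ℤ) :
    pmf P S r ^ 2 * (1 + 2 * variance (fun ω => (S ω : ℝ)) P) ≤ 1 := by
  have h := hlc.sq_mul_le_of_symm hfin (tsum_pmf hS) t ht r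
  rw [← integral_comp_eq_tsum hS hfin fun j => ((j : ℝ) - t / 2) ^ 2] at h
  refine le_trans ?_ h
  have hm := (memLp_comp hS hfin (fun j => (j : ℝ)) 2).aestronglyMeasurable
  have hm' := (memLp_comp hS hfin (fun j => (j : ℝ) - t / 2) 2).aestronglyMeasurable
  have := variance_le_expectation_sq hm'
  rw [variance_sub_const hm] at this
  have e := this
  simp only [Pi.pow_apply] at e
  gcongr

/-- Since `X - c` and `c - X` share an atom, `2 * c` is an integer. -/
theorem IsSymmetricAboutPoint.exists_pmf_eq {X : Ω → ℤ} (hX : Measurable X)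
    (h : IsSymmetricAboutPoint P X) : ∃ t : ℤ, ∀ j, pmf P X (t - j) = pmf P X j := by
  obtain ⟨c, hc⟩ := h
  have hXr : Measurable fun ω => (X ω : ℝ) := measurable_from_top.comp hX
  have key : ∀ y : ℝ, P.real {ω | (X ω : ℝ) - c = y} = P.real {ω | c - (X ω : ℝ) = y} := by
    intro y
    have := congrArg (fun μ => μ.real {y}) hc
    rwa [map_measureReal_apply (by fun_prop) (measurableSet_singleton y),
      map_measureReal_apply (by fun_prop) (measurableSet_singleton y)] at this
  have h1 : ∀ j : ℤ, pmf P X j = P.real {ω | (X ω : ℝ) = 2 * c - j} := by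
    intro j
    have := key (j - c)
    rw [show {ω | (X ω : ℝ) - c = j - c} = {ω | X ω = j} by ext; simp,
      show {ω | c - (X ω : ℝ) = j - c} = {ω | (X ω : ℝ) = 2 * c - j} by
        ext; simp only [Set.mem_ofPred_eq]; constructor <;> intro h <;> linarith] at this
    exact this
  obtain ⟨i, hi⟩ : ∃ i, pmf P X i ≠ 0 := by
    by_contra! hcon
    have := tsum_pmf (P := P) hX
    simp [hcon] at this
  obtain ⟨ω, hω⟩ : {ω | (X ω : ℝ) = 2 * c - i}.Nonempty := by
    by_contra hcon
    rw [h1, Set.not_nonempty_iff_eq_empty.1 hcon] at hi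
    simp at hi
  have ht : 2 * c = ((X ω + i : ℤ) : ℝ) := by
    push_cast; rw [show (X ω : ℝ) = 2 * c - i from hω]; ring
  refine ⟨X ω + i, fun j => ?_⟩
  rw [h1 j, ht]
  simp only [pmf]
  norm_cast

end Pmf

/-! ### Strict stochastic monotonicity given an integer statistic -/

section StrictlyIncreasingGiven

/-- `S` has a finitely supported log-concave law, and the conditional law of `Z` given `S = r + 1`
dominates strictly the conditional law of `Z` given `S = r`:
`ℙ (Z ≤ t | S = r + 1) ≤ ℙ (Z < t | S = r)` for all `t`. The inequality is stated with denominators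
cleared, so it is vacuous when one of the two conditioning events is null. It amounts to the
existence of a coupling of the two conditional laws in which the value of `Z` increases strictly. -/
structure StrictlyIncreasingGiven {Ω : Type*} [MeasurableSpace Ω] (P : Measure Ω) (Z : Ω → ℝ)
    (S : Ω → ℤ) : Prop where
  measurable_real : Measurable Z
  measurable_int : Measurable S
  logConcave : LogConcaveSeq (pmf P S)
  finite : IsFinitelySupported P S
  dom : ∀ (r : ℤ) (t : ℝ), P.real {ω | S ω = r + 1 ∧ Z ω ≤ t} * pmf P S r ≤
    P.real {ω | S ω = r ∧ Z ω < t} * pmf P S (r + 1)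

variable {Ω : Type*} [MeasurableSpace Ω] {P : Measure Ω} [IsProbabilityMeasure P]
  {Z : Ω → ℝ} {S : Ω → ℤ}

theorem measureReal_and_div_mul (S : Ω → ℤ) (p : Ω → Prop) (r : ℤ) :
    P.real {ω | S ω = r ∧ p ω} / pmf P S r * pmf P S r = P.real {ω | S ω = r ∧ p ω} := by
  rcases eq_or_ne (pmf P S r) 0 with h | h
  · rw [h, mul_zero]
    refine le_antisymm measureReal_nonneg ?_
    rw [← h]
    exact measureReal_mono fun ω hω => hω.1
  · exact div_mul_cancel₀ _ h

namespace StrictlyIncreasingGiven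

theorem zero : StrictlyIncreasingGiven P (fun _ => 0) (fun _ => 0) := by
  have h : ∀ j : ℤ, pmf P (fun _ => (0 : ℤ)) j = if j = 0 then 1 else 0 := by
    intro j
    rcases eq_or_ne j 0 with rfl | hj
    · simp [pmf]
    · simp [pmf, hj, hj.symm]
  refine ⟨measurable_const, measurable_const, ?_, ?_, ?_⟩
  · refine .of_adjacent (pmf_nonneg _) fun y z hyz => ?_
    simp only [h]
    split_ifs <;> first | omega | norm_num
  · refine (Set.finite_singleton (0 : ℤ)).subset fun j hj => ?_
    by_contra hne
    exact hj (by rw [h, if_neg (by simpa using hne)])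
  · intro r t
    refine le_trans (le_of_eq ?_) (mul_nonneg measureReal_nonneg (pmf_nonneg _ _))
    rcases eq_or_ne r 0 with rfl | hr
    · simp
    · rw [h, if_neg hr, mul_zero]

/-- Strict domination is preserved by adding an independent log-concave variable with a positive
coefficient: when `S + X` increases by one, either `S` or `X` increases by one, and in both cases
the value of `Z + a * X` increases. -/
theorem add (h : StrictlyIncreasingGiven P Z S) {X : Ω → ℤ} (hX : Measurable X)
    (hlc : LogConcaveSeq (pmf P X)) (hfin : IsFinitelySupported P X)
    (hind : IndepFun (fun ω => (Z ω, S ω)) X P) {a : ℝ} (ha : 0 < a) :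
    StrictlyIncreasingGiven P (fun ω => Z ω + a * X ω) (fun ω => S ω + X ω) := by
  have hXr : Measurable fun ω => (X ω : ℝ) := measurable_from_top.comp hX
  have hS := h.measurable_int
  have hZ := h.measurable_real
  have hSX : IndepFun S X P := hind.comp measurable_snd measurable_id
  have hconv := pmf_add hS hX hSX
  refine ⟨by fun_prop, by fun_prop, ?_, ?_, ?_⟩
  · rw [hconv]; exact h.logConcave.conv hlc hfin
  · rw [IsFinitelySupported, hconv]; exact finite_support_conv h.finite hfin
  intro r t
  set w := pmf P S with hw
  set q := pmf P X with hq
  have hw0 : ∀ i, 0 ≤ w i := h.logConcave.nonneg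
  have hq0 : ∀ i, 0 ≤ q i := hlc.nonneg
  have hfs : ∀ r : ℤ, (Function.support fun j => w (r - j) * q j).Finite := fun r =>
    hfin.subset fun j hj => right_ne_zero_of_mul hj
  have hle : P.real {ω | S ω + X ω = r + 1 ∧ Z ω + a * X ω ≤ t} =
      ∑' j, w (r + 1 - j) * q j *
        (P.real {ω | S ω = r + 1 - j ∧ Z ω ≤ t - a * j} / w (r + 1 - j)) := by
    have := measureReal_indep (hZ.prodMk hS) hX hind
      (C := fun j => {y | y.2 = r + 1 - j ∧ y.1 ≤ t - a * j}) fun j =>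
      (measurable_snd (measurableSet_singleton _)).inter (measurable_fst measurableSet_Iic)
    simp only [Set.mem_ofPred_eq] at this
    simp only [← eq_sub_iff_add_eq, ← le_sub_iff_add_le]
    rw [this]
    refine tsum_congr fun j => ?_
    rw [mul_right_comm, mul_comm (w _), measureReal_and_div_mul]
  have hlt : P.real {ω | S ω + X ω = r ∧ Z ω + a * X ω < t} =
      ∑' j, w (r - j) * q j * (P.real {ω | S ω = r - j ∧ Z ω < t - a * j} / w (r - j)) := by
    have := measureReal_indep (hZ.prodMk hS) hX hind
      (C := fun j => {y | y.2 = r - j ∧ y.1 < t - a * j}) fun j =>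
      (measurable_snd (measurableSet_singleton _)).inter (measurable_fst measurableSet_Iio)
    simp only [Set.mem_ofPred_eq] at this
    simp only [← eq_sub_iff_add_eq, ← lt_sub_iff_add_lt]
    rw [this]
    refine tsum_congr fun j => ?_
    rw [mul_right_comm, mul_comm (w _), measureReal_and_div_mul]
  rw [hle, hlt, hconv]
  refine tsum_mul_tsum_le_of_interlacing (hfs r) (hfs (r + 1))
    (fun j => mul_nonneg (hw0 _) (hq0 _)) (fun j => mul_nonneg (hw0 _) (hq0 _)) ?_ ?_ ?_ ?_
  · intro k l hkl
    have := h.logConcave.mul_le (a := r - l) (b := r - k) (c := r + 1 - l) (d := r + 1 - k)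
      (by omega) (by omega) (by ring)
    have h2 := mul_le_mul_of_nonneg_right this (mul_nonneg (hq0 k) (hq0 l))
    linarith
  · intro k l hkl
    have := hlc.mul_le (a := k) (b := k + 1) (c := l) (d := l + 1) (by omega) (by omega) (by ring)
    have h2 := mul_le_mul_of_nonneg_right this (mul_nonneg (hw0 (r - k)) (hw0 (r - l)))
    rw [show r + 1 - (l + 1) = r - l by ring, show r + 1 - (k + 1) = r - k by ring]
    linarith
  · intro j hu hv
    have hu' := pos_of_mul_pos_left hu (hq0 j)
    have hv' := pos_of_mul_pos_left hv (hq0 j)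
    rw [div_le_div_iff₀ hv' hu']
    have := h.dom (r - j) (t - a * j)
    rwa [show r - j + 1 = r + 1 - j by ring] at this
  · intro j hu hv
    rw [show r + 1 - (j + 1) = r - j by ring]
    refine div_le_div_of_nonneg_right (measureReal_mono fun ω hω => ⟨hω.1, hω.2.trans_lt ?_⟩)
      (hw0 _)
    push_cast
    linarith

/-- An atom of `Z` has probability at most the largest atom of `S`. In terms of conditional
probabilities, `ℙ (Z = x | S = r) = ℙ (Z ≤ x | S = r) - ℙ (Z < x | S = r)` is at most
`ℙ (Z ≤ x | S = r) - ℙ (Z ≤ x | S = r + 1)`, and the sum over `r` telescopes to at most `1`. -/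
theorem measureReal_eq_le (h : StrictlyIncreasingGiven P Z S) {B : ℝ} (hB : ∀ r, pmf P S r ≤ B)
    (x : ℝ) : P.real {ω | Z ω = x} ≤ B := by
  set w := pmf P S with hw
  have hw0 : ∀ i, 0 ≤ w i := h.logConcave.nonneg
  set g : ℤ → ℝ := fun r => P.real {ω | S ω = r ∧ Z ω ≤ x} / w r with hg
  set k : ℤ → ℝ := fun r => P.real {ω | S ω = r ∧ Z ω < x} / w r with hk
  have hk0 : ∀ r, 0 ≤ k r := fun r => div_nonneg measureReal_nonneg (hw0 r)
  have hg1 : ∀ r, g r ≤ 1 := fun r =>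
    div_le_one_of_le₀ (measureReal_mono fun ω hω => hω.1) (hw0 r)
  have hstep : ∀ r, 0 < w r → 0 < w (r + 1) → g (r + 1) ≤ k r := by
    intro r h1 h2
    simp only [hg, hk]
    rw [div_le_div_iff₀ h2 h1]
    exact h.dom r x
  have hkg : ∀ r, k r ≤ g r := fun r =>
    div_le_div_of_nonneg_right (measureReal_mono fun ω hω => ⟨hω.1, hω.2.le⟩) (hw0 r)
  have hB0 : 0 ≤ B := (hw0 0).trans (hB 0)
  have hpoint : ∀ r, P.real {ω | S ω = r ∧ Z ω = x} ≤ B * (g r - k r) := by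
    intro r
    have hd : P.real {ω | S ω = r ∧ Z ω ≤ x} =
        P.real {ω | S ω = r ∧ Z ω < x} + P.real {ω | S ω = r ∧ Z ω = x} := by
      rw [← measureReal_union]
      · congr 1; ext ω
        simp only [Set.mem_ofPred_eq, Set.mem_union, le_iff_lt_or_eq, and_or_left]
      · exact Set.disjoint_left.2 fun ω h1 h2 => h1.2.ne h2.2
      · exact (h.measurable_int (measurableSet_singleton r)).inter
          (h.measurable_real (measurableSet_singleton x))
    have e : P.real {ω | S ω = r ∧ Z ω = x} = (g r - k r) * w r := by
      rw [sub_mul, hg, hk]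
      simp only [hw, measureReal_and_div_mul]
      rw [hd]; ring
    rw [e, mul_comm]
    exact mul_le_mul_of_nonneg_right (hB r) (sub_nonneg.2 (hkg r))
  have htel : ∀ (n : ℕ) (lo : ℤ), 0 < w lo → 0 < w (lo + n) →
      ∑ i ∈ Finset.range (n + 1), (g (lo + i) - k (lo + i)) ≤ 1 - k (lo + n) := by
    intro n lo hlo
    induction n with
    | zero => intro _; simp [hg1]
    | succ n ih =>
      intro hn
      push_cast at hn ⊢
      have hmid : 0 < w (lo + n) := by
        have := h.logConcave.mul_le (a := lo) (b := lo + n) (c := lo + 1) (d := lo + (n + 1))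
          (by omega) (by omega) (by ring)
        exact (hw0 _).lt_of_ne' (left_ne_zero_of_mul ((mul_pos hlo hn).trans_le this).ne')
      have h1 := hstep (lo + n) hmid (by rwa [add_assoc])
      rw [add_assoc] at h1
      rw [Finset.sum_range_succ]
      push_cast
      linarith [ih hmid]
  have hE : MeasurableSet {ω | Z ω = x} := h.measurable_real (measurableSet_singleton x)
  rw [measureReal_eq_tsum h.measurable_int hE]
  have hsw : ∀ r, ({ω | Z ω = x} ∩ {ω | S ω = r} : Set Ω) = {ω | S ω = r ∧ Z ω = x} :=
    fun r => Set.inter_comm _ _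
  simp_rw [hsw]
  have hmem : ∀ j, j ∈ h.finite.toFinset ↔ w j ≠ 0 := fun j => h.finite.mem_toFinset
  have hne : h.finite.toFinset.Nonempty := by
    by_contra hcon
    have h0 : ∀ j, w j = 0 := fun j => by
      by_contra hj
      exact hcon ⟨j, (hmem j).2 hj⟩
    have := tsum_pmf (P := P) h.measurable_int
    rw [← hw] at this
    simp [h0] at this
  set lo := h.finite.toFinset.min' hne
  set hi := h.finite.toFinset.max' hne
  have hlo : 0 < w lo := (hw0 _).lt_of_ne' ((hmem _).1 (Finset.min'_mem _ hne))
  have hhi : 0 < w hi := (hw0 _).lt_of_ne' ((hmem _).1 (Finset.max'_mem _ hne))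
  have hlohi : lo ≤ hi := Finset.min'_le_max' _ hne
  obtain ⟨n, hn⟩ := Int.eq_ofNat_of_zero_le (sub_nonneg.2 hlohi)
  have hT := htel n lo hlo (by rwa [show lo + (n : ℤ) = hi by omega])
  rw [tsum_eq_sum (s := (Finset.range (n + 1)).image fun i : ℕ => lo + (i : ℤ)),
    Finset.sum_image (fun i _ j _ hij => by simpa using hij)]
  · calc _ ≤ ∑ i ∈ Finset.range (n + 1), B * (g (lo + i) - k (lo + i)) :=
        Finset.sum_le_sum fun i _ => hpoint _
      _ = B * ∑ i ∈ Finset.range (n + 1), (g (lo + i) - k (lo + i)) := (Finset.mul_sum ..).symm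
      _ ≤ B * 1 := mul_le_mul_of_nonneg_left (by linarith [hk0 (lo + n)]) hB0
      _ = B := mul_one B
  · intro r hr
    have hwr : w r = 0 := by
      by_contra hne0
      have hr' := (hmem r).2 hne0
      have h1 := Finset.min'_le _ r hr'
      have h2 := Finset.le_max' _ r hr'
      refine hr (Finset.mem_image.2 ⟨(r - lo).toNat, ?_, ?_⟩)
      · simp only [Finset.mem_range]; omega
      · omega
    refine le_antisymm ?_ measureReal_nonneg
    rw [← hwr]
    exact measureReal_mono fun ω hω => hω.1

end StrictlyIncreasingGiven
end StrictlyIncreasingGiven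

/-! ### Sums of independent log-concave variables -/

section Sum

theorem indepFun_pair_sum_of_notMem {Ω ι : Type*} [MeasurableSpace Ω] {P : Measure Ω}
    {X : ι → Ω → ℤ} (hX : ∀ k, Measurable (X k))
    (hindep : iIndepFun X P) (a : ι → ℝ) {s : Finset ι} {i : ι} (hi : i ∉ s) :
    IndepFun (fun ω => (∑ k ∈ s, a k * (X k ω : ℝ), ∑ k ∈ s, X k ω)) (X i) P := by
  have h := hindep.indepFun_finset s {i} (Finset.disjoint_singleton_right.2 hi) hX
  have hφ : Measurable fun v : s → ℤ => (∑ k : s, a k * (v k : ℝ), ∑ k : s, v k) :=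
    measurable_of_countable _
  have hψ : Measurable fun v : ({i} : Finset ι) → ℤ => v ⟨i, Finset.mem_singleton_self i⟩ :=
    measurable_pi_apply _
  have := h.comp hφ hψ
  simp only [Function.comp_def] at this
  convert this using 1
  ext ω
  · exact (Finset.sum_coe_sort s fun k => a k * (X k ω : ℝ)).symm
  · exact (Finset.sum_coe_sort s fun k => X k ω).symm

variable {Ω : Type*} [MeasurableSpace Ω] {P : Measure Ω} [IsProbabilityMeasure P]

theorem StrictlyIncreasingGiven.sum {ι : Type*} {X : ι → Ω → ℤ} (hX : ∀ k, Measurable (X k))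
    (hindep : iIndepFun X P) (hlc : ∀ k, LogConcaveSeq (pmf P (X k)))
    (hfin : ∀ k, IsFinitelySupported P (X k)) {a : ι → ℝ} (ha : ∀ k, 0 < a k) (s : Finset ι) :
    StrictlyIncreasingGiven P (fun ω => ∑ k ∈ s, a k * (X k ω : ℝ)) (fun ω => ∑ k ∈ s, X k ω) := by
  classical
  induction s using Finset.induction_on with
  | empty => simpa using StrictlyIncreasingGiven.zero
  | insert i s hi ih =>
    simp_rw [Finset.sum_insert hi, add_comm (_ * _ : ℝ), add_comm (X i _)]
    exact ih.add (hX i) (hlc i) (hfin i) (indepFun_pair_sum_of_notMem hX hindep a hi) (ha i)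

theorem exists_pmf_sum_symm {ι : Type*} {X : ι → Ω → ℤ} (hX : ∀ k, Measurable (X k))
    (hindep : iIndepFun X P) (hsymm : ∀ k, ∃ t : ℤ, ∀ j, pmf P (X k) (t - j) = pmf P (X k) j)
    (s : Finset ι) : ∃ t : ℤ, ∀ j, pmf P (fun ω => ∑ k ∈ s, X k ω) (t - j) =
      pmf P (fun ω => ∑ k ∈ s, X k ω) j := by
  classical
  induction s using Finset.induction_on with
  | empty =>
    refine ⟨0, fun j => ?_⟩
    simp only [Finset.sum_empty, pmf, zero_sub, eq_comm (a := (0 : ℤ)), neg_eq_zero]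
  | insert i s hi ih =>
    obtain ⟨t, ht⟩ := ih
    obtain ⟨u, hu⟩ := hsymm i
    have hind : IndepFun (fun ω => ∑ k ∈ s, X k ω) (X i) P :=
      (indepFun_pair_sum_of_notMem hX hindep (fun _ => 0) hi).comp measurable_snd measurable_id
    refine ⟨t + u, fun j => ?_⟩
    simp_rw [Finset.sum_insert hi, add_comm (X i _)]
    rw [pmf_add (by fun_prop) (hX i) hind]
    exact conv_symm ht hu j

theorem variance_sum_eq {ι : Type*} [Fintype ι] {X : ι → Ω → ℤ} (hX : ∀ k, Measurable (X k))
    (hindep : iIndepFun X P) (hfin : ∀ k, IsFinitelySupported P (X k)) :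
    variance (fun ω => ((∑ k, X k ω : ℤ) : ℝ)) P = ∑ k, variance (fun ω => (X k ω : ℝ)) P := by
  rw [← IndepFun.variance_sum (fun k _ => memLp_comp (hX k) (hfin k) (fun j => (j : ℝ)) 2)]
  · congr 1; ext ω; simp
  · intro i _ j _ hij
    exact (hindep.indepFun hij).comp (measurable_of_countable fun j : ℤ => (j : ℝ))
      (measurable_of_countable fun j : ℤ => (j : ℝ))

end Sum

/-! ### The uniform law on `{1, …, l}` -/

section Uniform

/-- The uniform probability measure on `{1, …, l} ⊆ ℤ`. -/
noncomputable def uniformIcc (l : ℕ) (hl : 1 ≤ l) : Measure ℤ :=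
  (PMF.uniformOfFinset (Finset.Icc (1 : ℤ) l) (Finset.nonempty_Icc.2 (by omega))).toMeasure

instance (l : ℕ) (hl : 1 ≤ l) : IsProbabilityMeasure (uniformIcc l hl) :=
  PMF.toMeasure.isProbabilityMeasure _

theorem pmf_uniformIcc (l : ℕ) (hl : 1 ≤ l) (j : ℤ) :
    pmf (uniformIcc l hl) id j = if 1 ≤ j ∧ j ≤ l then (l : ℝ)⁻¹ else 0 := by
  have : {ω : ℤ | id ω = j} = {j} := by ext; simp
  rw [pmf, this, Measure.real, uniformIcc,
    PMF.toMeasure_apply_singleton _ _ (measurableSet_singleton j), PMF.uniformOfFinset_apply]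
  split_ifs <;> simp_all

theorem isFinitelySupported_uniformIcc (l : ℕ) (hl : 1 ≤ l) :
    IsFinitelySupported (uniformIcc l hl) id := by
  refine (Set.finite_Icc (1 : ℤ) l).subset fun j hj => ?_
  by_contra hcon
  exact hj (by rw [pmf_uniformIcc, if_neg (by simpa using hcon)])

theorem logConcaveSeq_uniformIcc (l : ℕ) (hl : 1 ≤ l) :
    LogConcaveSeq (pmf (uniformIcc l hl) id) := by
  refine .of_adjacent (pmf_nonneg _) fun y z hyz => ?_
  simp only [pmf_uniformIcc]
  have : (0 : ℝ) ≤ (l : ℝ)⁻¹ * (l : ℝ)⁻¹ := by positivity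
  split_ifs <;> first | omega | linarith

theorem pmf_uniformIcc_symm (l : ℕ) (hl : 1 ≤ l) (j : ℤ) :
    pmf (uniformIcc l hl) id ((l + 1) - j) = pmf (uniformIcc l hl) id j := by
  simp only [pmf_uniformIcc]
  congr 1
  rw [eq_iff_iff]
  omega

theorem integral_uniformIcc (l : ℕ) (hl : 1 ≤ l) (g : ℤ → ℝ) :
    ∫ j, g j ∂uniformIcc l hl = (∑ i ∈ Finset.range l, g (i + 1)) / l := by
  refine (integral_comp_eq_tsum measurable_id (isFinitelySupported_uniformIcc l hl) g).trans ?_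
  rw [tsum_eq_sum (s := (Finset.range l).image fun i : ℕ => (i : ℤ) + 1),
    Finset.sum_image (fun i _ j _ hij => by simpa using hij), Finset.sum_div]
  · refine Finset.sum_congr rfl fun i hi => ?_
    rw [Finset.mem_range] at hi
    rw [pmf_uniformIcc, if_pos (by omega), div_eq_mul_inv]
  · intro j hj
    rw [pmf_uniformIcc, if_neg, mul_zero]
    intro hcon
    exact hj (Finset.mem_image.2 ⟨(j - 1).toNat, by simp only [Finset.mem_range]; omega, by omega⟩)

theorem variance_uniformIcc (l : ℕ) (hl : 1 ≤ l) :
    variance (fun j : ℤ => (j : ℝ)) (uniformIcc l hl) = ((l : ℝ) ^ 2 - 1) / 12 := by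
  have hl0 : (l : ℝ) ≠ 0 := by positivity
  have hm : MemLp (fun j : ℤ => (j : ℝ)) 2 (uniformIcc l hl) :=
    memLp_comp measurable_id (isFinitelySupported_uniformIcc l hl) (fun j => (j : ℝ)) 2
  rw [variance_eq_sub hm]
  simp only [Pi.pow_apply]
  rw [integral_uniformIcc l hl fun j => (j : ℝ) ^ 2, integral_uniformIcc l hl fun j => (j : ℝ)]
  have h1 : ∀ n : ℕ, ∑ i ∈ Finset.range n, (((i : ℤ) + 1 : ℤ) : ℝ) = n * (n + 1) / 2 := by
    intro n
    induction n with
    | zero => simp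
    | succ n ih => rw [Finset.sum_range_succ, ih]; push_cast; ring
  have h2 : ∀ n : ℕ, ∑ i ∈ Finset.range n, (((i : ℤ) + 1 : ℤ) : ℝ) ^ 2 =
      n * (n + 1) * (2 * n + 1) / 6 := by
    intro n
    induction n with
    | zero => simp
    | succ n ih => rw [Finset.sum_range_succ, ih]; push_cast; ring
  rw [h1, h2]
  field_simp
  ring

end Uniform

/-! ### Hitting an arithmetic progression -/

section MeasurePreserving

variable {Ω Ω' : Type*} [MeasurableSpace Ω] [MeasurableSpace Ω'] {P : Measure Ω} {P' : Measure Ω'}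
  {Z : Ω → ℝ} {S : Ω → ℤ}

theorem pmf_comp_measurePreserving (hS : Measurable S) {φ : Ω' → Ω}
    (hφ : MeasurePreserving φ P' P) : pmf P' (S ∘ φ) = pmf P S := by
  ext j
  exact hφ.measureReal_preimage (hS (measurableSet_singleton j)).nullMeasurableSet

theorem StrictlyIncreasingGiven.comp_measurePreserving (h : StrictlyIncreasingGiven P Z S)
    {φ : Ω' → Ω} (hφ : MeasurePreserving φ P' P) :
    StrictlyIncreasingGiven P' (Z ∘ φ) (S ∘ φ) := by
  have hpmf := pmf_comp_measurePreserving h.measurable_int hφ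
  refine ⟨h.measurable_real.comp hφ.measurable, h.measurable_int.comp hφ.measurable, ?_, ?_, ?_⟩
  · rw [hpmf]; exact h.logConcave
  · rw [IsFinitelySupported, hpmf]; exact h.finite
  · intro r t
    have h1 : MeasurableSet {ω | S ω = r + 1 ∧ Z ω ≤ t} :=
      (h.measurable_int (measurableSet_singleton _)).inter (h.measurable_real measurableSet_Iic)
    have h2 : MeasurableSet {ω | S ω = r ∧ Z ω < t} :=
      (h.measurable_int (measurableSet_singleton _)).inter (h.measurable_real measurableSet_Iio)
    have := h.dom r t
    rw [← hφ.measureReal_preimage h1.nullMeasurableSet,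
      ← hφ.measureReal_preimage h2.nullMeasurableSet] at this
    rw [hpmf]
    exact this

end MeasurePreserving

section ArithProg

variable {Ω : Type*} [MeasurableSpace Ω] {P : Measure Ω} [IsProbabilityMeasure P]
  {Z : Ω → ℝ} {S : Ω → ℤ}

/-- Reading a progression backwards. -/
theorem arithProg_neg (l : ℕ) (m x : ℝ) :
    arithProg l m x = arithProg l (-m) (x + m * (l + 1)) := by
  ext y
  constructor
  all_goals
    rintro ⟨j, h1, h2, rfl⟩
    refine ⟨l + 1 - j, by omega, by omega, ?_⟩
    rw [Nat.cast_sub (by omega)]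
    push_cast
    ring

/-- Adjoining an independent variable with uniform law on `{1, …, l}`. -/
theorem StrictlyIncreasingGiven.add_uniform (h : StrictlyIncreasingGiven P Z S) {l : ℕ}
    (hl : 1 ≤ l) {a : ℝ} (ha : 0 < a) :
    StrictlyIncreasingGiven (P.prod (uniformIcc l hl)) (fun y => Z y.1 + a * y.2)
      (fun y => S y.1 + y.2) := by
  have hpmf : pmf (P.prod (uniformIcc l hl)) Prod.snd = pmf (uniformIcc l hl) id :=
    pmf_comp_measurePreserving measurable_id measurePreserving_snd
  refine (h.comp_measurePreserving measurePreserving_fst).add measurable_snd ?_ ?_ ?_ ha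
  · rw [hpmf]; exact logConcaveSeq_uniformIcc l hl
  · rw [IsFinitelySupported, hpmf]; exact isFinitelySupported_uniformIcc l hl
  · exact indepFun_prod (X := fun ω => (Z ω, S ω)) (Y := fun j : ℤ => j)
      (h.measurable_real.prodMk h.measurable_int) measurable_id

theorem pmf_add_uniform_symm (hS : Measurable S) {l : ℕ} (hl : 1 ≤ l) {t : ℤ}
    (ht : ∀ j, pmf P S (t - j) = pmf P S j) (r : ℤ) :
    pmf (P.prod (uniformIcc l hl)) (fun y => S y.1 + y.2) (t + (l + 1) - r) =
      pmf (P.prod (uniformIcc l hl)) (fun y => S y.1 + y.2) r := by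
  have e1 : pmf (P.prod (uniformIcc l hl)) (fun y => S y.1) = pmf P S :=
    pmf_comp_measurePreserving hS measurePreserving_fst
  have e2 : pmf (P.prod (uniformIcc l hl)) Prod.snd = pmf (uniformIcc l hl) id :=
    pmf_comp_measurePreserving measurable_id measurePreserving_snd
  have hS' : Measurable fun y : Ω × ℤ => S y.1 := hS.comp measurable_fst
  rw [pmf_add hS' measurable_snd (indepFun_prod (Y := fun j : ℤ => j) hS measurable_id), e1, e2]
  exact conv_symm ht (pmf_uniformIcc_symm l hl) r

theorem variance_add_uniform (hS : Measurable S) (hfin : IsFinitelySupported P S) {l : ℕ}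
    (hl : 1 ≤ l) :
    variance (fun y => ((S y.1 + y.2 : ℤ) : ℝ)) (P.prod (uniformIcc l hl)) =
      variance (fun ω => (S ω : ℝ)) P + ((l : ℝ) ^ 2 - 1) / 12 := by
  have hfst : MeasurePreserving Prod.fst (P.prod (uniformIcc l hl)) P := measurePreserving_fst
  have hsnd : MeasurePreserving Prod.snd (P.prod (uniformIcc l hl)) (uniformIcc l hl) :=
    measurePreserving_snd
  have hc : Measurable fun j : ℤ => (j : ℝ) := measurable_of_countable _
  have m1 : MemLp (fun y : Ω × ℤ => (S y.1 : ℝ)) 2 (P.prod (uniformIcc l hl)) :=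
    (memLp_comp hS hfin (fun j => (j : ℝ)) 2).comp_measurePreserving hfst
  have m2 : MemLp (fun y : Ω × ℤ => (y.2 : ℝ)) 2 (P.prod (uniformIcc l hl)) :=
    (memLp_comp measurable_id (isFinitelySupported_uniformIcc l hl)
      (fun j => (j : ℝ)) 2).comp_measurePreserving hsnd
  have hind : IndepFun (fun y : Ω × ℤ => (S y.1 : ℝ)) (fun y => (y.2 : ℝ))
      (P.prod (uniformIcc l hl)) :=
    indepFun_prod (X := fun ω => (S ω : ℝ)) (hc.comp hS) hc
  have e1 : variance (fun y : Ω × ℤ => (S y.1 : ℝ)) (P.prod (uniformIcc l hl)) =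
      variance (fun ω => (S ω : ℝ)) P :=
    hfst.variance_fun_comp (f := fun ω => (S ω : ℝ)) (hc.comp hS).aemeasurable
  rw [← variance_uniformIcc l hl, ← e1, ← hsnd.variance_fun_comp hc.aemeasurable,
    ← hind.variance_add m1 m2]
  congr 1
  ext y
  simp

/-- Hitting a progression with nonzero difference is, up to the factor `l`, an atom of `Z - m * J`
with `J` independent of `Z` and uniform on `{1, …, l}`. -/
theorem measureReal_mem_arithProg (hZ : Measurable Z) {l : ℕ} (hl : 1 ≤ l) {m : ℝ} (hm : m ≠ 0)
    (x : ℝ) : P.real {ω | Z ω ∈ arithProg l m x} =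
      l * (P.prod (uniformIcc l hl)).real {y | Z y.1 + -m * y.2 = x} := by
  have hfst : MeasurePreserving Prod.fst (P.prod (uniformIcc l hl)) P := measurePreserving_fst
  have hpmf : pmf (P.prod (uniformIcc l hl)) Prod.snd = pmf (uniformIcc l hl) id :=
    pmf_comp_measurePreserving measurable_id measurePreserving_snd
  have h1 := measureReal_indep (P := P.prod (uniformIcc l hl)) (Y := fun y => Z y.1)
    (X := Prod.snd) (hZ.comp measurable_fst) measurable_snd
    (indepFun_prod (Y := fun j : ℤ => j) hZ measurable_id) (C := fun j => {x + m * j})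
    fun j => measurableSet_singleton _
  have e : {y : Ω × ℤ | Z y.1 + -m * y.2 = x} = {y | Z y.1 ∈ ({x + m * y.2} : Set ℝ)} := by
    ext y
    simp only [Set.mem_ofPred_eq, Set.mem_singleton_iff]
    constructor <;> intro h <;> linarith
  have h2 : ∀ j : ℤ, (P.prod (uniformIcc l hl)).real {y | Z y.1 ∈ ({x + m * j} : Set ℝ)} =
      P.real {ω | Z ω = x + m * j} := fun j =>
    hfst.measureReal_preimage (hZ (measurableSet_singleton _)).nullMeasurableSet
  rw [e, h1, hpmf]
  simp_rw [h2]
  have hinj : Function.Injective fun j : ℤ => x + m * j := fun i j hij => by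
    have := add_left_cancel hij
    exact_mod_cast mul_left_cancel₀ hm this
  have hunion : {ω | Z ω ∈ arithProg l m x} =
      ⋃ j ∈ Finset.Icc (1 : ℤ) l, {ω | Z ω = x + m * j} := by
    ext ω
    simp only [arithProg, Set.mem_ofPred_eq, Set.mem_iUnion, Finset.mem_Icc, exists_prop]
    constructor
    · rintro ⟨j, h1, h2, h3⟩
      exact ⟨j, ⟨by omega, by omega⟩, by simpa using h3⟩
    · rintro ⟨j, ⟨h1, h2⟩, h3⟩
      refine ⟨j.toNat, by omega, by omega, ?_⟩
      rw [h3]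
      congr 2
      rw [← Int.cast_natCast, Int.toNat_of_nonneg (by omega)]
  rw [hunion, measureReal_biUnion_finset]
  · rw [tsum_eq_sum (s := Finset.Icc (1 : ℤ) l), Finset.mul_sum]
    · refine Finset.sum_congr rfl fun j hj => ?_
      rw [pmf_uniformIcc, if_pos (Finset.mem_Icc.1 hj)]
      have : (l : ℝ) ≠ 0 := by positivity
      field_simp
    · intro j hj
      rw [pmf_uniformIcc, if_neg (fun h => hj (Finset.mem_Icc.2 h)), mul_zero]
  · intro i _ j _ hij
    exact Set.disjoint_left.2 fun ω h1 h2 => hij (hinj (h1.symm.trans h2))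
  · exact fun j _ => hZ (measurableSet_singleton _)

theorem StrictlyIncreasingGiven.measureReal_mem_arithProg_le (h : StrictlyIncreasingGiven P Z S)
    {l : ℕ} (hl : 1 ≤ l) {m : ℝ} (hm : m ≠ 0) {B : ℝ}
    (hB : ∀ r, pmf (P.prod (uniformIcc l hl)) (fun y => S y.1 + y.2) r ≤ B) (x : ℝ) :
    P.real {ω | Z ω ∈ arithProg l m x} ≤ l * B := by
  -- The coefficient `-m` of the uniform variable has to be positive.
  wlog hm' : m < 0 generalizing m x
  · rw [arithProg_neg]
    exact this (neg_ne_zero.2 hm) _ (neg_lt_zero.2 (lt_of_le_of_ne (not_lt.1 hm') hm.symm))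
  rw [measureReal_mem_arithProg h.measurable_real hl hm]
  have := (h.add_uniform hl (neg_pos.2 hm')).measureReal_eq_le hB x
  gcongr

end ArithProg

theorem le_one_div_sqrt {p v : ℝ} (hv : 0 < v) (h : p ^ 2 * v ≤ 1) : p ≤ 1 / √v := by
  rw [le_div_iff₀ (Real.sqrt_pos.2 hv)]
  refine le_of_sq_le_sq ?_ zero_le_one
  rw [mul_pow, Real.sq_sqrt hv.le]
  simpa using h

/-- A bound `pmf ^ 2 * (1 + c * Var) ≤ 1` for the laws of `S` and of `S + J`, with `J` independent
and uniform on `{1, …, l}`, yields the concentration bound for arithmetic progressions. The law of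
`S` alone is used for the degenerate progressions with difference `0`. -/
theorem StrictlyIncreasingGiven.iSup_arithProg_le {Ω : Type*} [MeasurableSpace Ω] {P : Measure Ω}
    [IsProbabilityMeasure P] {Z : Ω → ℝ} {S : Ω → ℤ} (h : StrictlyIncreasingGiven P Z S) {l : ℕ}
    (hl : 1 ≤ l) (m : ℝ) {c : ℝ} (hc0 : 0 ≤ c) (hc2 : c ≤ 2)
    (h1 : ∀ r, pmf P S r ^ 2 * (1 + c * variance (fun ω => (S ω : ℝ)) P) ≤ 1)
    (h2 : ∀ r, pmf (P.prod (uniformIcc l hl)) (fun y => S y.1 + y.2) r ^ 2 *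
      (1 + c * variance (fun y => ((S y.1 + y.2 : ℤ) : ℝ)) (P.prod (uniformIcc l hl))) ≤ 1) :
    ⨆ x : ℝ, P.real {ω | Z ω ∈ arithProg l m x} ≤
      l / √(1 + c * variance (fun ω => (S ω : ℝ)) P + c * (((l : ℝ) ^ 2 - 1) / 12)) := by
  have hl1 : (1 : ℝ) ≤ l := by exact_mod_cast hl
  have hV := variance_nonneg (fun ω => (S ω : ℝ)) P
  have hq : 0 ≤ ((l : ℝ) ^ 2 - 1) / 12 := by nlinarith
  set V := variance (fun ω => (S ω : ℝ)) P
  refine ciSup_le fun x => ?_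
  rcases eq_or_ne m 0 with rfl | hm
  · have hset : {ω | Z ω ∈ arithProg l 0 x} ⊆ {ω | Z ω = x} := by
      rintro ω ⟨j, -, -, hj⟩
      simpa using hj
    refine (measureReal_mono hset).trans ((h.measureReal_eq_le
      (fun r => le_one_div_sqrt (by positivity) (h1 r)) x).trans ?_)
    rw [div_le_div_iff₀ (Real.sqrt_pos.2 (by positivity)) (Real.sqrt_pos.2 (by positivity)), one_mul]
    refine Real.sqrt_le_iff.2 ⟨by positivity, ?_⟩
    rw [mul_pow, Real.sq_sqrt (by positivity)]
    have : 0 ≤ c * V := by positivity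
    nlinarith
  · rw [variance_add_uniform h.measurable_int h.finite hl] at h2
    rw [div_eq_mul_one_div]
    refine h.measureReal_mem_arithProg_le hl hm
      (fun r => le_one_div_sqrt (by positivity) ?_) x
    rw [add_assoc, ← mul_add]
    exact h2 r

theorem logConcaveSeq_neg {p : ℤ → ℝ} (hp : LogConcaveSeq p) : LogConcaveSeq fun j => p (-j) where
  nonneg _ := hp.nonneg _
  mul_le {a b c d} h1 h2 h3 := by
    rw [mul_comm]
    exact hp.mul_le (by omega) (by omega) (by omega)

/-- The concentration bounds when all coefficients are positive. -/
theorem concentration_of_pos {Ω : Type*} [MeasurableSpace Ω] (P : Measure Ω) [IsProbabilityMeasure P]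
    (n : ℕ) (X : Fin n → Ω → ℤ)
    (hX : ∀ k, Measurable (X k))
    (hindep : iIndepFun X P)
    (hlc : ∀ k, LogConcaveSeq (pmf P (X k)))
    (hfin : ∀ k, IsFinitelySupported P (X k))
    (a : Fin n → ℝ) (ha : ∀ k, 0 < a k)
    (l : ℕ) (hl : 1 ≤ l) (m : ℝ) :
    (⨆ x : ℝ, P.real {ω | ∑ k, a k * (X k ω : ℝ) ∈ arithProg l m x}) ≤
        (l : ℝ) / √(1 + 1 * ∑ k, variance (fun ω => (X k ω : ℝ)) P
          + 1 * (((l : ℝ) ^ 2 - 1) / 12)) ∧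
    ((∀ k, ∃ t : ℤ, ∀ j, pmf P (X k) (t - j) = pmf P (X k) j) →
      (⨆ x : ℝ, P.real {ω | ∑ k, a k * (X k ω : ℝ) ∈ arithProg l m x}) ≤
        (l : ℝ) / √(1 + 2 * ∑ k, variance (fun ω => (X k ω : ℝ)) P
          + 2 * (((l : ℝ) ^ 2 - 1) / 12))) := by
  have hS := StrictlyIncreasingGiven.sum hX hindep hlc hfin ha Finset.univ
  have hSJ := hS.add_uniform hl one_pos
  rw [← variance_sum_eq hX hindep hfin]
  constructor
  · refine hS.iSup_arithProg_le hl m zero_le_one one_le_two (fun r => ?_) fun r => ?_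
    · rw [one_mul]
      exact sq_pmf_mul_variance_le hS.measurable_int hS.finite hS.logConcave r
    · rw [one_mul]
      exact sq_pmf_mul_variance_le hSJ.measurable_int hSJ.finite hSJ.logConcave r
  · intro hsymm
    obtain ⟨t, ht⟩ := exists_pmf_sum_symm hX hindep hsymm Finset.univ
    refine hS.iSup_arithProg_le hl m zero_le_two le_rfl (fun r => ?_) fun r => ?_
    · exact sq_pmf_mul_variance_le_of_symm hS.measurable_int hS.finite hS.logConcave ht r
    · exact sq_pmf_mul_variance_le_of_symm hSJ.measurable_int hSJ.finite hSJ.logConcave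
        (pmf_add_uniform_symm hS.measurable_int hl ht) r

end LittlewoodOfford

open LittlewoodOfford in
theorem theorem1p3 {Ω : Type*} [MeasurableSpace Ω] (P : Measure Ω) [IsProbabilityMeasure P]
    (n : ℕ) (hn : 1 ≤ n) (X : Fin n → Ω → ℤ)
    (hX : ∀ k, Measurable (X k))
    (hindep : iIndepFun X P)
    (hlc : ∀ k, LittlewoodOfford.IsDiscreteLogConcave P (X k))
    (hfin : ∀ k, LittlewoodOfford.IsFinitelySupported P (X k))
    (a : Fin n → ℝ) (ha : ∀ k, a k ≠ 0)
    (l : ℕ) (hl : 1 ≤ l) (m : ℝ) :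
    (⨆ x : ℝ, P.real {ω | ∑ k, a k * (X k ω : ℝ) ∈ LittlewoodOfford.arithProg l m x}) ≤
        (l : ℝ) / √(1 + 1 * ∑ k, variance (fun ω => (X k ω : ℝ)) P
          + 1 * (((l : ℝ) ^ 2 - 1) / 12)) ∧
    ((∀ k, LittlewoodOfford.IsSymmetricAboutPoint P (X k)) →
      (⨆ x : ℝ, P.real {ω | ∑ k, a k * (X k ω : ℝ) ∈ LittlewoodOfford.arithProg l m x}) ≤
        (l : ℝ) / √(1 + 2 * ∑ k, variance (fun ω => (X k ω : ℝ)) P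
          + 2 * (((l : ℝ) ^ 2 - 1) / 12))) := by
  -- Reflecting the variables with negative coefficient makes all coefficients positive.
  set Y : Fin n → Ω → ℤ := fun k ω => if 0 < a k then X k ω else -X k ω with hYdef
  have hYpos : ∀ k, 0 < a k → Y k = X k := fun k hk => by ext ω; simp [hYdef, hk]
  have hYneg : ∀ k, ¬ 0 < a k → Y k = fun ω => -X k ω := fun k hk => by ext ω; simp [hYdef, hk]
  have hpmf : ∀ k, ¬ 0 < a k → pmf P (Y k) = fun j => pmf P (X k) (-j) := fun k hk => by
    ext j
    rw [hYneg k hk]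
    simp only [pmf, neg_eq_iff_eq_neg]
  have hYm : ∀ k, Measurable (Y k) := fun k => by
    by_cases hk : 0 < a k
    · rw [hYpos k hk]; exact hX k
    · rw [hYneg k hk]; exact (hX k).neg
  have hYind : iIndepFun Y P :=
    hindep.comp (fun k j => if 0 < a k then j else -j) fun k => measurable_of_countable _
  have hYlc : ∀ k, LogConcaveSeq (pmf P (Y k)) := fun k => by
    by_cases hk : 0 < a k
    · rw [hYpos k hk]; exact (hlc k).logConcaveSeq
    · rw [hpmf k hk]; exact logConcaveSeq_neg (hlc k).logConcaveSeq
  have hYfin : ∀ k, IsFinitelySupported P (Y k) := fun k => by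
    by_cases hk : 0 < a k
    · rw [hYpos k hk]; exact hfin k
    · rw [IsFinitelySupported, hpmf k hk]
      exact (hfin k).preimage neg_injective.injOn
  have hYsum : ∀ ω, ∑ k, |a k| * (Y k ω : ℝ) = ∑ k, a k * (X k ω : ℝ) := fun ω => by
    refine Finset.sum_congr rfl fun k _ => ?_
    by_cases hk : 0 < a k
    · rw [hYpos k hk, abs_of_pos hk]
    · rw [hYneg k hk, abs_of_nonpos (not_lt.1 hk)]; push_cast; ring
  have hYvar : ∀ k, variance (fun ω => (Y k ω : ℝ)) P = variance (fun ω => (X k ω : ℝ)) P :=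
    fun k => by
      by_cases hk : 0 < a k
      · rw [hYpos k hk]
      · rw [hYneg k hk]; push_cast; exact variance_fun_neg
  have main := concentration_of_pos P n Y hYm hYind hYlc hYfin (fun k => |a k|) (fun k => abs_pos.2 (ha k))
    l hl m
  simp only [hYsum, hYvar] at main
  refine ⟨main.1, fun hsymm => main.2 fun k => ?_⟩
  obtain ⟨t, ht⟩ := (hsymm k).exists_pmf_eq (hX k)
  by_cases hk : 0 < a k
  · rw [hYpos k hk]; exact ⟨t, ht⟩
  · rw [hpmf k hk]
    refine ⟨-t, fun j => ?_⟩
    simp only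
    rw [← ht]
    congr 1; ring
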